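/- Let $K$ be a field of characteristic $0$, let $E$ be a $K$-vector space of dimension $m$, and let $A=\mathrm{Sym}(E)$ with its standard grading. Let $\mathbf d=(d_0<d_1<\dots<d_m)$ be a strictly increasing sequence of integers and put $e_i=d_i-d_{i-1}$ for $1\le i\le m$. Let $\lambda_i=d_0+\sum_{j=i+1}^m(e_j-1)$ for $1\le i\le m$, and for $0\le i\le m$ let $$\alpha(\mathbf d,i)=(\lambda_1+e_1,\dots,\lambda_i+e_i,\lambda_{i+1},\dots,\lambda_m).$$ Let $S_\alpha E$ denote the Schur functor (the irreducible representation of $GL(E)$ of highest weight $\alpha$); for a partition $\nu$ and $p\in\mathbf Z$, $S_{\nu+(p^m)}E=S_\nu E\otimes(\wedge^mE)^{\otimes p}$. Put $F(\mathbf d)_i=S_{\alpha(\mathbf d,i)}E\otimes_K A(-d_i)$, a $GL(E)$-equivariant graded free $A$-module generated in degree $d_i$, and let $\mathbf F(\mathbf d)_\bullet$ be the sequence $$0\to F(\mathbf d)_m\xrightarrow{\varphi_m}F(\mathbf d)_{m-1}\to\cdots\to F(\mathbf d)_1\xrightarrow{\varphi_1}F(\mathbf d)_0\to0,$$ where each $\varphi_i$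 is a nonzero $GL(E)$-equivariant homomorphism of graded $A$-modules (of degree $0$). Assume that the sequence $(e_1,\dots,e_m)$ is symmetric, i.e. $e_i=e_{m+1-i}$ for $i=1,\dots,m$, and put $c=d_0+d_m+1-m$ (so that $c=\lambda_1+e_1+d_0$ if $m\ge1$, and $c=\lambda_1+e_1$ if moreover $d_0=0$). Then: 1. Maps $\varphi_1,\dots,\varphi_m$ as above exist, and for every choice of them $\mathbf F(\mathbf d)_\bullet$ is a complex, i.e. $\varphi_i\varphi_{i+1}=0$ for $1\le i<m$. 2. The weights $\alpha(\mathbf d,i)$ and $\alpha(\mathbf d,m-i)$ are complementary: $\alpha(\mathbf d,i)_j+\alpha(\mathbf d,m-i)_{m+1-j}=c$ for all $0\le i\le m$ and $1\le j\le m$. 3. For every choice of the $\varphi_i$ the complex $\mathbf F(\mathbf d)_\bullet$ is self-dual: there are nondegenerate $GL(E)$-equivariant pairings $$S_{\alpha(\mathbf d,i)}E\otimes S_{\alpha(\mathbf d,m-i)}E\to(\wedge^mE)^{\otimes c}\qquad(0\le i\le m)$$ and an isomorphism of complexes of $GL(E)$-equivariant graded $A$-modules $$\mathbf F(\mathbf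 d)_\bullet^*\otimes(\wedge^mE)^{\otimes c}(-d_0-d_m)\;\cong\;\mathbf F(\mathbf d)_\bullet$$ which extends these pairings. Here $F^*=\mathrm{Hom}_A(F,A)$, the module $F(\mathbf d)_{m-i}^*$ is placed in homological degree $i$, and the differentials of $\mathbf F(\mathbf d)_\bullet^*$ are the transposes of the $\varphi_i$. That the isomorphism extends the pairings means that the functional on $F(\mathbf d)_{m-i}$ corresponding to a generator $s\in S_{\alpha(\mathbf d,i)}E$ takes on $t\in S_{\alpha(\mathbf d,m-i)}E$ the value of the pairing at $s\otimes t$. -/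

import Mathlib

open scoped TensorProduct

namespace PureFree

section Degrees

/-!
Degree sequences `d = (d_0 < ⋯ < d_m)`. Positions `1, …, m` of the mathematics are represented by
`Fin m = {0, …, m-1}`: the index `j : Fin m` stands for position `j + 1`.
-/

variable {m : ℕ} (d : Fin (m + 1) → ℤ)

/-- The difference sequence: `diffSeq d j` is `e_{j+1} = d_{j+1} - d_j`. -/
def diffSeq (j : Fin m) : ℤ := d j.succ - d j.castSucc

/-- The partition `λ_j = d_0 + ∑_{k > j} (e_k - 1)`. -/
def lam (j : Fin m) : ℤ := d 0 + ∑ k ∈ Finset.Ioi j, (diffSeq d k - 1)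

/-- The weights `α(d, i) = (λ_1 + e_1, …, λ_i + e_i, λ_{i+1}, …, λ_m)`, for `i = 0, …, m`. -/
def alpha (i : Fin (m + 1)) (j : Fin m) : ℤ :=
  lam d j + if (j : ℕ) < (i : ℕ) then diffSeq d j else 0

/-- The partition `α(d, i) - (d_0, …, d_0)`, as a sequence of row lengths. For `d` strictly
increasing all its entries are nonnegative, see `shape_cast`. -/
def shape (i : Fin (m + 1)) (j : Fin m) : ℕ := (alpha d i j - d 0).toNat

/-- The side `d_0 + d_m + 1 - m` of the rectangle for the duality. For `m ≥ 1` and `e` symmetric it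
equals `λ_1 + e_1 + d_0`. -/
def dualWeight : ℤ := d 0 + d (Fin.last m) + 1 - (m : ℤ)

variable {d}

lemma diffSeq_pos (hd : StrictMono d) (j : Fin m) : 0 < diffSeq d j :=
  sub_pos.2 (hd (Fin.castSucc_lt_succ))

lemma shape_cast (hd : StrictMono d) (i : Fin (m + 1)) (j : Fin m) :
    (shape d i j : ℤ) = alpha d i j - d 0 := by
  refine Int.toNat_of_nonneg ?_
  have h1 : 0 ≤ ∑ k ∈ Finset.Ioi j, (diffSeq d k - 1) :=
    Finset.sum_nonneg fun k _ => by linarith [diffSeq_pos hd k]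
  have h2 : (0 : ℤ) ≤ if (j : ℕ) < (i : ℕ) then diffSeq d j else 0 := by
    split_ifs
    · exact (diffSeq_pos hd j).le
    · exact le_rfl
  unfold alpha lam
  linarith

end Degrees

section Schur

/-! Schur functors, by Young symmetrizers. -/

/-- The boxes of the Young frame whose row `j` has `ν j` boxes. -/
abbrev Box {m : ℕ} (ν : Fin m → ℕ) : Type := Σ j : Fin m, Fin (ν j)

/-- The permutations of the boxes preserving every row. -/
def rowPerms {m : ℕ} (ν : Fin m → ℕ) : Finset (Equiv.Perm (Box ν)) :=
  Finset.univ.filter fun σ => ∀ b, (σ b).1 = b.1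

/-- The permutations of the boxes preserving every column. -/
def colPerms {m : ℕ} (ν : Fin m → ℕ) : Finset (Equiv.Perm (Box ν)) :=
  Finset.univ.filter fun σ => ∀ b, ((σ b).2 : ℕ) = (b.2 : ℕ)

variable (K : Type*) [Field K] (E : Type*) [AddCommGroup E] [Module K E]
variable {m : ℕ} (ν : Fin m → ℕ)

/-- The tensor power of `E` with one factor for each box. -/
abbrev BoxTensor : Type _ := ⨂[K] _ : Box ν, E

/-- A permutation of the boxes permutes the tensor factors. -/
noncomputable def permAct (σ : Equiv.Perm (Box ν)) : BoxTensor K E ν →ₗ[K] BoxTensor K E ν :=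
  (PiTensorProduct.reindex K (fun _ : Box ν => E) σ).toLinearMap

/-- The Young symmetrizer: symmetrize along the rows, then antisymmetrize along the columns. -/
noncomputable def youngSymmetrizer : BoxTensor K E ν →ₗ[K] BoxTensor K E ν :=
  (∑ σ ∈ colPerms ν, ((Equiv.Perm.sign σ : ℤ) : K) • permAct K E ν σ) ∘ₗ
    (∑ σ ∈ rowPerms ν, permAct K E ν σ)

/-- The Schur functor `S_ν E` of a partition `ν`: the image of the Young symmetrizer. -/
noncomputable abbrev SchurModule : Type _ := LinearMap.range (youngSymmetrizer K E ν)

/-- The group `GL(E)`. -/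
abbrev GLin : Type _ := LinearMap.GeneralLinearGroup K E

/-- The diagonal action of `GL(E)` on the tensor power. -/
noncomputable def tensorRep : Representation K (GLin K E) (BoxTensor K E ν) where
  toFun g := PiTensorProduct.map fun _ => (g : E →ₗ[K] E)
  map_one' := PiTensorProduct.map_one
  map_mul' g h := PiTensorProduct.map_mul (fun _ => (g : E →ₗ[K] E)) (fun _ => (h : E →ₗ[K] E))

lemma tensorRep_permAct (g : GLin K E) (σ : Equiv.Perm (Box ν)) (x : BoxTensor K E ν) :
    tensorRep K E ν g (permAct K E ν σ x) = permAct K E ν σ (tensorRep K E ν g x) :=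
  PiTensorProduct.map_reindex (fun _ => (g : E →ₗ[K] E)) σ x

lemma tensorRep_youngSymmetrizer (g : GLin K E) (x : BoxTensor K E ν) :
    tensorRep K E ν g (youngSymmetrizer K E ν x) =
      youngSymmetrizer K E ν (tensorRep K E ν g x) := by
  simp [youngSymmetrizer, tensorRep_permAct]

/-- The action of `GL(E)` on `S_ν E`. -/
noncomputable def schurRep : Representation K (GLin K E) (SchurModule K E ν) :=
  (tensorRep K E ν).subrepresentation (LinearMap.range (youngSymmetrizer K E ν)) (by
    rintro g _ ⟨x, rfl⟩
    exact ⟨tensorRep K E ν g x, (tensorRep_youngSymmetrizer K E ν g x).symm⟩)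

/-- An endomorphism `g` of an `m`-dimensional space `E` acts on `⋀^m E` as the scalar `det g`. -/
lemma exteriorPower_map_eq_det_smul [FiniteDimensional K E] (hm : Module.finrank K E = m)
    (g : E →ₗ[K] E) (x : ⋀[K]^m E) : exteriorPower.map m g x = LinearMap.det g • x := by
  let b := Module.finBasisOfFinrankEq K E hm
  have h : exteriorPower.map m g = LinearMap.det g • (LinearMap.id : ⋀[K]^m E →ₗ[K] _) := by
    apply exteriorPower.linearMap_ext
    refine Module.Basis.ext_alternating b fun v hv => ?_
    obtain ⟨σ, rfl⟩ : ∃ σ : Equiv.Perm (Fin m), v = σ :=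
      ⟨Equiv.ofBijective v (Finite.injective_iff_bijective.1 hv), rfl⟩
    have key : ∀ f : (⋀[K]^m E) →ₗ[K] K,
        f (exteriorPower.ιMulti K m (fun i => g (b (σ i)))) =
          f (LinearMap.det g • exteriorPower.ιMulti K m (fun i => b (σ i))) := by
      intro f
      have h1 := AlternatingMap.eq_smul_basis_det b
        (f.compAlternatingMap (exteriorPower.ιMulti K m))
      have h2 := fun w => DFunLike.congr_fun h1 w
      simp only [LinearMap.compAlternatingMap_apply, AlternatingMap.smul_apply] at h2
      rw [map_smul, h2, h2 (fun i => b (σ i))]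
      have h3 := b.det_comp g (fun i => b (σ i))
      simp only [Function.comp_def] at h3
      rw [h3]; simp only [smul_eq_mul]; ring
    have h4 := (Module.forall_dual_apply_eq_zero_iff K
      (exteriorPower.ιMulti K m (fun i => g (b (σ i))) -
        LinearMap.det g • exteriorPower.ιMulti K m (fun i => b (σ i)))).1
      (fun f => by rw [map_sub, key, sub_self])
    simpa [sub_eq_zero, Function.comp_def] using h4
  simp [h]

/-- The character of `GL(E)` on the one-dimensional representation `(⋀^m E)^{⊗ p}`, where
`m = dim E` and `p` is any integer: the `p`-th power of the determinant
(see `exteriorPower_map_eq_det_smul`). -/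
noncomputable def detPow (p : ℤ) : GLin K E →* K where
  toFun g := (LinearMap.det (g : E →ₗ[K] E)) ^ p
  map_one' := by simp
  map_mul' g h := by simp [mul_zpow]

/-- The representation `S_ν E ⊗ (⋀^m E)^{⊗ p} = S_{ν + (p, …, p)} E`, carried by the space
`S_ν E`. -/
noncomputable def twistedSchurRep (p : ℤ) : Representation K (GLin K E) (SchurModule K E ν) where
  toFun g := detPow K E p g • schurRep K E ν g
  map_one' := by simp
  map_mul' g h := by
    ext x
    simp [mul_smul, smul_comm (detPow K E p h)]

end Schur

section Modules

/-!
The polynomial ring `A = Sym(E)` and the graded `A`-modules with `GL(E)`-action `F(d)_i`.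
-/

variable (K : Type*) [Field K] (E : Type*) [AddCommGroup E] [Module K E]

/-- `A = Sym(E)`. -/
abbrev PolyRing : Type _ := SymmetricAlgebra K E

/-- The action of `g ∈ GL(E)` on `A` by algebra automorphisms. -/
noncomputable def symMap (g : GLin K E) : PolyRing K E →ₐ[K] PolyRing K E :=
  SymmetricAlgebra.lift (SymmetricAlgebra.ι K E ∘ₗ (g : E →ₗ[K] E))

noncomputable def symRep : Representation K (GLin K E) (PolyRing K E) where
  toFun g := (symMap K E g).toLinearMap
  map_one' := by
    have h : symMap K E 1 = AlgHom.id K (PolyRing K E) :=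
      SymmetricAlgebra.algHom_ext (by ext; simp [symMap])
    rw [h]; rfl
  map_mul' g h := by
    have h : symMap K E (g * h) = (symMap K E g).comp (symMap K E h) :=
      SymmetricAlgebra.algHom_ext (by ext; simp [symMap])
    rw [h]; rfl

/-- The homogeneous component `A_n = Sym^n(E)`; it is zero for `n < 0`. -/
noncomputable def symDeg (n : ℤ) : Submodule K (PolyRing K E) :=
  if 0 ≤ n then LinearMap.range (SymmetricAlgebra.ι K E) ^ n.toNat else ⊥

variable {m : ℕ} (d : Fin (m + 1) → ℤ)

/-- The space underlying `S_{α(d, i)} E = S_{α(d, i) - (d_0, …, d_0)} E ⊗ (⋀^m E)^{⊗ d_0}`. -/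
noncomputable abbrev Gen (i : Fin (m + 1)) : Type _ := SchurModule K E (shape d i)

/-- The representation `S_{α(d, i)} E` of `GL(E)`. -/
noncomputable abbrev genRep (i : Fin (m + 1)) : Representation K (GLin K E) (Gen K E d i) :=
  twistedSchurRep K E (shape d i) (d 0)

/-- The free `A`-module `F(d)_i = A(-d_i) ⊗ S_{α(d, i)} E`. -/
noncomputable abbrev Term (i : Fin (m + 1)) : Type _ := PolyRing K E ⊗[K] Gen K E d i

/-- The diagonal action of `GL(E)` on `F(d)_i`. -/
noncomputable def termRep (i : Fin (m + 1)) : Representation K (GLin K E) (Term K E d i) :=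
  (symRep K E).tprod (genRep K E d i)

/-- The component of degree `n` of `F(d)_i`, which is `A_{n - d_i} ⊗ S_{α(d, i)} E`. -/
noncomputable def termDeg (i : Fin (m + 1)) (n : ℤ) : Submodule K (Term K E d i) :=
  LinearMap.range
    (TensorProduct.map (symDeg K E (n - d i)).subtype
      (LinearMap.id : Gen K E d i →ₗ[K] Gen K E d i))

lemma termRep_smul (i : Fin (m + 1)) (g : GLin K E) (a : PolyRing K E) (x : Term K E d i) :
    termRep K E d i g (a • x) = symMap K E g a • termRep K E d i g x := by
  induction x using TensorProduct.induction_on with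
  | zero => simp
  | tmul b s => simp [termRep, symRep, TensorProduct.smul_tmul']
  | add x y hx hy => simp only [smul_add, map_add, hx, hy]

/-- A family `φ_k : F(d)_k → F(d)_{k-1}`, `k = 1, …, m`, of differentials for `F(d)`: each `φ_k` is
a nonzero `GL(E)`-equivariant homomorphism of graded `A`-modules (of degree `0`). Here `φ k`, for
`k : Fin m`, stands for `φ_{k+1} : F(d)_{k+1} → F(d)_k`. -/
structure IsDifferential (φ : ∀ k : Fin m, Term K E d k.succ →ₗ[PolyRing K E] Term K E d k.castSucc) :
    Prop where
  ne_zero : ∀ k, φ k ≠ 0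
  equivariant : ∀ k (g : GLin K E) x,
    φ k (termRep K E d k.succ g x) = termRep K E d k.castSucc g (φ k x)
  degree : ∀ (k : Fin m) (n : ℤ) (x : Term K E d k.succ),
    x ∈ termDeg K E d k.succ n → φ k x ∈ termDeg K E d k.castSucc n

/-- The dual module `F(d)_i^* = Hom_A(F(d)_i, A)`. -/
noncomputable abbrev DualTerm (i : Fin (m + 1)) : Type _ := Module.Dual (PolyRing K E) (Term K E d i)

/-- The action of `GL(E)` on `F(d)_i^*`: `(g f)(x) = g (f (g⁻¹ x))`. -/
noncomputable def dualAct (i : Fin (m + 1)) (g : GLin K E) (f : DualTerm K E d i) :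
    DualTerm K E d i where
  toFun x := symMap K E g (f (termRep K E d i g⁻¹ x))
  map_add' x y := by simp only [map_add]
  map_smul' a x := by
    have h : symMap K E g (symMap K E g⁻¹ a) = a := (symRep K E).self_inv_apply g a
    rw [termRep_smul, map_smul, smul_eq_mul, map_mul, h, RingHom.id_apply, smul_eq_mul]

/-- A functional `f ∈ F(d)_i^*` is homogeneous of degree `n` if it raises degrees by `n`. -/
def IsDualHomogeneous (i : Fin (m + 1)) (n : ℤ) (f : DualTerm K E d i) : Prop :=
  ∀ (k : ℤ) (x : Term K E d i), x ∈ termDeg K E d i k → f x ∈ symDeg K E (k + n)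

/-- Self-duality of the complex `F(d)` with differentials `φ`, up to the shifts forced by degrees
and weights. With `c = dualWeight d`, it consists of

* `GL(E)`-equivariant nondegenerate pairings
  `S_{α(d, i)} E ⊗ S_{α(d, m-i)} E → (⋀^m E)^{⊗ c}`, and
* an isomorphism of complexes of `GL(E)`-equivariant graded `A`-modules
  `F(d)^* ⊗ (⋀^m E)^{⊗ c} (-d_0 - d_m) ≅ F(d)`, where `F(d)_j^*` is placed in homological degree
  `m - j`, extending these pairings. -/
structure SelfDuality
    (φ : ∀ k : Fin m, Term K E d k.succ →ₗ[PolyRing K E] Term K E d k.castSucc) where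
  pairing : ∀ i j : Fin (m + 1), (i : ℕ) + j = m → (Gen K E d i →ₗ[K] Gen K E d j →ₗ[K] K)
  pairing_nondegenerate : ∀ i j h, (pairing i j h).Nondegenerate
  pairing_equivariant : ∀ i j h (g : GLin K E) s t,
    pairing i j h (genRep K E d i g s) (genRep K E d j g t) =
      detPow K E (dualWeight d) g * pairing i j h s t
  iso : ∀ i j : Fin (m + 1), (i : ℕ) + j = m → (DualTerm K E d j ≃ₗ[PolyRing K E] Term K E d i)
  /-- The squares with the differential `φ_{k+1} : F_{k+1} → F_k` and the transpose of
  `φ_{l+1} : F_{l+1} → F_l`, where `k + l + 1 = m`, commute. -/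
  iso_comm : ∀ (k l : Fin m) (h : (k : ℕ) + l + 1 = m) (f : DualTerm K E d l.castSucc),
    φ k (iso k.succ l.castSucc (by simp; omega) f) =
      iso k.castSucc l.succ (by simp; omega) (f ∘ₗ φ l)
  iso_equivariant : ∀ i j h (g : GLin K E) (f : DualTerm K E d j),
    detPow K E (dualWeight d) g • iso i j h (dualAct K E d j g f) = termRep K E d i g (iso i j h f)
  iso_degree : ∀ i j h (n : ℤ) (f : DualTerm K E d j),
    IsDualHomogeneous K E d j n f ↔ iso i j h f ∈ termDeg K E d i (n + (d 0 + d (Fin.last m)))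
  iso_extends : ∀ i j h (s : Gen K E d i) (t : Gen K E d j),
    (iso i j h).symm (1 ⊗ₜ s) (1 ⊗ₜ t) = algebraMap K (PolyRing K E) (pairing i j h s t)

end Modules

end PureFree

/-! The whole theorem rests on Pieri's rule for equivariant maps `f : S_ν E → Sym E ⊗ S_μ E`. Apply
the functional dual to the highest weight vector of `S_μ E` to the second factor of `f(v)`, with `v`
the highest weight vector of `S_ν E`. The resulting polynomial `lead b f` determines `f`
(`IsEquivariant.eq_zero`), and torus weights force it to be a multiple of `x^(ν-μ)`
(`IsEquivariant.toPoly_lead`). Hence such maps form a space of dimension at most one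
(`IsEquivariant.exists_smul`). The space is nonzero when `ν/μ` lies in one row (`pieriMap_ne_zero`),
and zero when `ν/μ` lies in two rows and has two boxes in one column
(`IsEquivariant.eq_zero_of_column`).

The weight `α(d,i)` arises from `α(d,i-1)` by adding `e_i` boxes to row `i`, so the maps `φ_i`
exist. The new boxes in rows `i` and `i+1` share exactly one column (`shape_overlap`), so `φ_i
φ_{i+1}` is an equivariant map of a kind that must vanish.

If `e` is symmetric, `α(d,i)` and the rotated `α(d,m-i)` fill a rectangle after removing the twist
by `d_0`. Multiplying the determinants of the columns of this rectangle of vectors gives a perfect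
pairing of the two Schur modules (`schurPairing_nondegenerate`), hence `F_{m-i}^* ≅ F_i`.
Transported through these isomorphisms, the transpose of `φ_{m+1-i}` is a nonzero equivariant map
`F_i → F_{i-1}`, so it is proportional to `φ_i` by multiplicity one. Rescaling the isomorphisms
successively absorbs the factors.

The facts on Schur modules come from Young symmetrizers by two devices: a positivity argument for
the signed sums over row and column permutations (`permSum_eq_zero`), and the density of matrices
with an LU decomposition (`eq_zero_of_row_eval`). -/

namespace PureFree

/-! ### Signed sums over permutation groups, and positivity. -/

section SignedSums

variable {B ι : Type*}

/-- A subgroup of permutations (given as a finset) together with a sign character on it. -/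
structure IsSignedSubgroup (H : Finset (Equiv.Perm B)) (χ : Equiv.Perm B → ℤ) : Prop where
  one_mem : 1 ∈ H
  mul_mem : ∀ {σ τ}, σ ∈ H → τ ∈ H → σ * τ ∈ H
  inv_mem : ∀ {σ}, σ ∈ H → σ⁻¹ ∈ H
  map_mul : ∀ σ τ, χ (σ * τ) = χ σ * χ τ
  mul_self : ∀ σ, χ σ * χ σ = 1

namespace IsSignedSubgroup

variable {H : Finset (Equiv.Perm B)} {χ : Equiv.Perm B → ℤ}

lemma map_one (hH : IsSignedSubgroup H χ) : χ 1 = 1 := by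
  have h := hH.map_mul 1 1
  rw [one_mul, hH.mul_self] at h
  exact h

lemma map_inv (hH : IsSignedSubgroup H χ) (σ : Equiv.Perm B) : χ σ⁻¹ = χ σ := by
  have h := hH.map_mul σ σ⁻¹
  rw [mul_inv_cancel, hH.map_one] at h
  calc χ σ⁻¹ = (χ σ * χ σ) * χ σ⁻¹ := by rw [hH.mul_self, one_mul]
    _ = χ σ * (χ σ * χ σ⁻¹) := by ring
    _ = χ σ := by rw [← h, mul_one]

lemma sum_mul_left (hH : IsSignedSubgroup H χ) {M : Type*} [AddCommMonoid M] {τ : Equiv.Perm B} (hτ : τ ∈ H)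
    (f : Equiv.Perm B → M) : ∑ σ ∈ H, f (τ * σ) = ∑ σ ∈ H, f σ :=
  Finset.sum_bij' (fun σ _ => τ * σ) (fun σ _ => τ⁻¹ * σ)
    (fun _ h => hH.mul_mem hτ h) (fun _ h => hH.mul_mem (hH.inv_mem hτ) h)
    (by simp) (by simp) (by simp)

lemma sum_mul_right (hH : IsSignedSubgroup H χ) {M : Type*} [AddCommMonoid M] {τ : Equiv.Perm B} (hτ : τ ∈ H)
    (f : Equiv.Perm B → M) : ∑ σ ∈ H, f (σ * τ) = ∑ σ ∈ H, f σ :=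
  Finset.sum_bij' (fun σ _ => σ * τ) (fun σ _ => σ * τ⁻¹)
    (fun _ h => hH.mul_mem h hτ) (fun _ h => hH.mul_mem h (hH.inv_mem hτ))
    (by simp) (by simp) (by simp)

lemma sum_inv (hH : IsSignedSubgroup H χ) {M : Type*} [AddCommMonoid M]
    (f : Equiv.Perm B → M) : ∑ σ ∈ H, f σ⁻¹ = ∑ σ ∈ H, f σ :=
  Finset.sum_bij' (fun σ _ => σ⁻¹) (fun σ _ => σ⁻¹)
    (fun _ h => hH.inv_mem h) (fun _ h => hH.inv_mem h)
    (by simp) (by simp) (by simp)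

lemma card_pos (hH : IsSignedSubgroup H χ) : 0 < H.card := Finset.card_pos.2 ⟨1, hH.one_mem⟩

end IsSignedSubgroup

/-- The signed sum of the translates of a function on fillings. -/
def permSum (H : Finset (Equiv.Perm B)) (χ : Equiv.Perm B → ℤ) {M : Type*} [AddCommGroup M]
    (x : (B → ι) → M) : (B → ι) → M :=
  fun S => ∑ σ ∈ H, χ σ • x (S ∘ σ)

section

variable {H : Finset (Equiv.Perm B)} {χ : Equiv.Perm B → ℤ} {M N : Type*} [AddCommGroup M]
  [AddCommGroup N]

lemma permSum_map (f : M →+ N) (x : (B → ι) → M) :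
    permSum H χ (fun S => f (x S)) = fun S => f (permSum H χ x S) := by
  funext S
  simp [permSum]

lemma permSum_comp (hH : IsSignedSubgroup H χ) {τ : Equiv.Perm B} (hτ : τ ∈ H) (x : (B → ι) → M)
    (S : B → ι) : permSum H χ x (S ∘ τ) = χ τ • permSum H χ x S := by
  unfold permSum
  rw [Finset.smul_sum, ← hH.sum_mul_left hτ (fun σ => χ τ • χ σ • x (S ∘ σ))]
  refine Finset.sum_congr rfl fun σ _ => ?_
  rw [hH.map_mul, smul_smul, ← mul_assoc, hH.mul_self, one_mul]
  rfl

lemma permSum_of_comp (hH : IsSignedSubgroup H χ) (x : (B → ι) → M) (S : B → ι)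
    (hx : ∀ τ ∈ H, x (S ∘ τ) = χ τ • x S) : permSum H χ x S = (H.card : ℤ) • x S := by
  have h : ∀ τ ∈ H, χ τ • x (S ∘ τ) = x S := fun τ hτ => by
    rw [hx τ hτ, smul_smul, hH.mul_self, one_smul]
  rw [permSum, Finset.sum_congr rfl h]
  simp

lemma permSum_permSum (hH : IsSignedSubgroup H χ) (x : (B → ι) → M) :
    permSum H χ (permSum H χ x) = (H.card : ℤ) • permSum H χ x := by
  funext S
  exact permSum_of_comp hH _ S fun τ hτ => permSum_comp hH hτ x S

lemma sum_permSum_mul {k : Type*} [CommRing k] [Fintype B] [DecidableEq B] [Fintype ι] (hH : IsSignedSubgroup H χ)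
    (x y : (B → ι) → k) :
    ∑ S, permSum H χ x S * y S = ∑ S, x S * permSum H χ y S := by
  simp only [permSum, Finset.sum_mul, Finset.mul_sum]
  rw [Finset.sum_comm, Finset.sum_comm (s := Finset.univ) (t := H),
    ← hH.sum_inv (fun σ => ∑ S, x S * χ σ • y (S ∘ σ))]
  refine Finset.sum_congr rfl fun σ _ => ?_
  refine Fintype.sum_equiv (Equiv.arrowCongr σ⁻¹ (Equiv.refl ι)) _ _ fun S => ?_
  have h : (Equiv.arrowCongr σ⁻¹ (Equiv.refl ι)) S = S ∘ σ := by
    rfl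
  rw [h, hH.map_inv]
  have h2 : (S ∘ σ) ∘ (σ⁻¹ : Equiv.Perm B) = S := by funext b; simp
  rw [h2]
  simp only [zsmul_eq_mul]
  ring

/-- Both signed sums `p`, `q` are self-adjoint for the standard form and are idempotent up to a
positive factor. With `y = p x`, the square norm of `q y` is a multiple of `⟨y, q y⟩ = ⟨x, p q y⟩ =
0`, and over `ℚ` this form is anisotropic. -/
lemma permSum_eq_zero_rat [Fintype B] [DecidableEq B] [Fintype ι] {H' : Finset (Equiv.Perm B)} {χ' : Equiv.Perm B → ℤ}
    (hH : IsSignedSubgroup H χ) (hH' : IsSignedSubgroup H' χ') (x : (B → ι) → ℚ)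
    (h : permSum H χ (permSum H' χ' (permSum H χ x)) = 0) :
    permSum H' χ' (permSum H χ x) = 0 := by
  set y := permSum H χ x with hy
  have h1 : ∑ S, y S * permSum H' χ' y S = 0 := by
    rw [hy, sum_permSum_mul hH, ← hy, h]
    simp
  have h2 : ∑ S, permSum H' χ' y S * permSum H' χ' y S = 0 := by
    rw [sum_permSum_mul hH', permSum_permSum hH']
    simp only [Pi.smul_apply, mul_smul_comm]
    rw [← Finset.smul_sum, h1, smul_zero]
  funext S
  have h3 := (Finset.sum_eq_zero_iff_of_nonneg (fun S _ => mul_self_nonneg _)).1 h2 S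
    (Finset.mem_univ S)
  exact mul_self_eq_zero.1 h3

/-- If `p`, `q` are the signed sums over two subgroups, `p q p x = 0` implies `q p x = 0`. -/
lemma permSum_eq_zero {k : Type*} [Field k] [CharZero k] [Fintype B] [DecidableEq B] [Fintype ι]
    {H' : Finset (Equiv.Perm B)} {χ' : Equiv.Perm B → ℤ}
    (hH : IsSignedSubgroup H χ) (hH' : IsSignedSubgroup H' χ') (x : (B → ι) → k)
    (h : permSum H χ (permSum H' χ' (permSum H χ x)) = 0) :
    permSum H' χ' (permSum H χ x) = 0 := by
  funext S
  -- The signed sums have integer coefficients, so they commute with `ℚ`-linear functionals `k → ℚ`;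
  -- these separate points and reduce the claim to `ℚ`.
  refine (Module.forall_dual_apply_eq_zero_iff ℚ _).1 fun θ => ?_
  have key := permSum_eq_zero_rat hH hH' (fun S => θ (x S))
  have e1 := permSum_map (H := H) (χ := χ) θ.toAddMonoidHom x
  simp only [LinearMap.toAddMonoidHom_coe] at e1
  have e2 := permSum_map (H := H') (χ := χ') θ.toAddMonoidHom (permSum H χ x)
  simp only [LinearMap.toAddMonoidHom_coe] at e2
  have e3 := permSum_map (H := H) (χ := χ) θ.toAddMonoidHom (permSum H' χ' (permSum H χ x))
  simp only [LinearMap.toAddMonoidHom_coe] at e3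
  rw [e1, e2, e3, h] at key
  have := key (by funext; simp)
  exact congr_fun this S

end

end SignedSums

/-! ### Combinatorics of fillings with distinct entries in each column. -/

section Fillings

variable {m : ℕ} {ν : Fin m → ℕ}

lemma rowPerms_isSigned (ν : Fin m → ℕ) : IsSignedSubgroup (rowPerms ν) (fun _ => 1) where
  one_mem := by simp [rowPerms]
  mul_mem := by
    intro σ τ hσ hτ
    simp only [rowPerms, Finset.mem_filter, Finset.mem_univ, true_and] at *
    intro b
    rw [Equiv.Perm.mul_apply, hσ, hτ]
  inv_mem := by
    intro σ hσ
    simp only [rowPerms, Finset.mem_filter, Finset.mem_univ, true_and] at *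
    intro b
    simpa using (hσ (σ⁻¹ b)).symm
  map_mul := by simp
  mul_self := by simp

lemma colPerms_isSigned (ν : Fin m → ℕ) :
    IsSignedSubgroup (colPerms ν) (fun σ => (Equiv.Perm.sign σ : ℤ)) where
  one_mem := by simp [colPerms]
  mul_mem := by
    intro σ τ hσ hτ
    simp only [colPerms, Finset.mem_filter, Finset.mem_univ, true_and] at *
    intro b
    rw [Equiv.Perm.mul_apply, hσ, hτ]
  inv_mem := by
    intro σ hσ
    simp only [colPerms, Finset.mem_filter, Finset.mem_univ, true_and] at *
    intro b
    obtain ⟨c, rfl⟩ := σ.surjective b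
    have h : σ⁻¹ (σ c) = c := by simp
    rw [h, hσ]
  map_mul := by simp
  mul_self σ := by
    rw [← Units.val_mul, Int.units_mul_self, Units.val_one]

/-- The filling whose entries in row `j` are all equal to `j`. -/
def rowFill (ν : Fin m → ℕ) : Box ν → Fin m := Sigma.fst

/-- The entries of a filling are distinct within each column. -/
def ColInj (S : Box ν → Fin m) : Prop :=
  ∀ b b' : Box ν, (b.2 : ℕ) = b'.2 → S b = S b' → b = b'

lemma box_ext {b b' : Box ν} (h1 : b.1 = b'.1) (h2 : (b.2 : ℕ) = b'.2) : b = b' := by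
  obtain ⟨j, l⟩ := b
  obtain ⟨j', l'⟩ := b'
  dsimp only at h1
  subst h1
  congr 1
  exact Fin.ext h2

/-- In a column-injective filling of a partition with entries `≤` the row index, all entries are
equal to the row index. -/
lemma ColInj.eq_rowFill (hν : Antitone ν) {S : Box ν → Fin m} (hS : ColInj S)
    (hle : ∀ b, S b ≤ b.1) : S = rowFill ν := by
  have h : ∀ (n : ℕ) (b : Box ν), (b.1 : ℕ) = n → S b = b.1 := by
    intro n
    induction n using Nat.strong_induction_on with
    | _ n ih =>
      intro b hb
      by_contra hne
      have hlt : S b < b.1 := lt_of_le_of_ne (hle b) hne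
      -- The box of the same column in the higher row `S b` has, by induction, the entry `S b` too,
      -- against injectivity on the column.
      let b' : Box ν := ⟨S b, ⟨b.2, lt_of_lt_of_le b.2.2 (hν hlt.le)⟩⟩
      have h1 := ih (S b) (by rw [← hb]; exact hlt) b' rfl
      have h2 := hS b b' rfl h1.symm
      exact hne (congrArg Sigma.fst h2).symm
  funext b
  exact h _ b rfl

/-- A column-injective filling such that the entries of each column are row indices of boxes in
that column arises from `rowFill` by a permutation of the boxes within columns. -/
lemma ColInj.exists_colPerm {S : Box ν → Fin m} (hS : ColInj S)
    (h : ∀ b : Box ν, (b.2 : ℕ) < ν (S b)) : ∃ σ ∈ colPerms ν, S = rowFill ν ∘ σ := by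
  let f : Box ν → Box ν := fun b => ⟨S b, ⟨b.2, h b⟩⟩
  have hf : Function.Injective f := by
    intro b b' hb
    have h1 : S b = S b' := congrArg Sigma.fst hb
    have h2 : (b.2 : ℕ) = b'.2 := by
      have := congrArg (fun c : Box ν => (c.2 : ℕ)) hb
      exact this
    exact hS b b' h2 h1
  refine ⟨Equiv.ofBijective f (Finite.injective_iff_bijective.1 hf), ?_, ?_⟩
  · simp [colPerms, f]
  · funext b
    simp [rowFill, f]

/-- Number of entries in a set `J`, in a column-injective filling. -/
lemma ColInj.card_le (hν : Antitone ν) {S : Box ν → Fin m} (hS : ColInj S) (k : Fin m)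
    (J : Finset (Fin m)) (hJ : J.card ≤ (k : ℕ) + 1) :
    (Finset.univ.filter fun b => S b ∈ J).card ≤
      (Finset.univ.filter fun b : Box ν => b.1 ≤ k).card := by
  classical
  let c : Box ν → ℕ := fun b => b.2
  let t : Finset ℕ := Finset.univ.image c
  rw [Finset.card_eq_sum_card_fiberwise (f := c) (t := t) (fun b _ => by simp [t]),
    Finset.card_eq_sum_card_fiberwise (f := c) (t := t) (fun b _ => by simp [t])]
  refine Finset.sum_le_sum fun l _ => ?_
  -- Compare column by column. A column reaching row `k` has `k + 1` boxes in rows `≤ k`, and at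
  -- most `J.card` entries in `J`; a shorter column lies entirely in rows `≤ k`.
  by_cases hl : l < ν k
  · calc _ ≤ J.card := by
          refine Finset.card_le_card_of_injOn S (fun b hb => ?_) ?_
          · simp only [Finset.coe_filter, Finset.mem_filter, Finset.mem_univ, true_and,
              Set.mem_ofPred_eq] at hb
            exact hb.1
          · intro b hb b' hb' h
            simp only [Finset.coe_filter, Finset.mem_filter, Finset.mem_univ, true_and,
              Set.mem_ofPred_eq] at hb hb'
            exact hS b b' (hb.2.trans hb'.2.symm) h
      _ ≤ (k : ℕ) + 1 := hJ
      _ = (Finset.Iic k).card := by simp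
      _ ≤ _ := by
          refine Finset.card_le_card_of_injOn
            (fun j => if h : l < ν j then (⟨j, ⟨l, h⟩⟩ : Box ν) else ⟨k, ⟨l, hl⟩⟩)
            (fun j hj => ?_) ?_
          · have hj' : j ≤ k := by simpa using hj
            have h : l < ν j := lt_of_lt_of_le hl (hν hj')
            simp [h, hj', c]
          · intro j hj j' hj' h
            have h1 : l < ν j := lt_of_lt_of_le hl (hν (by simpa using hj))
            have h2 : l < ν j' := lt_of_lt_of_le hl (hν (by simpa using hj'))
            simp only [h1, h2, dif_pos] at h
            exact congrArg Sigma.fst h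
  · refine Finset.card_le_card fun b hb => ?_
    simp only [Finset.mem_filter, Finset.mem_univ, true_and] at hb ⊢
    refine ⟨?_, hb.2⟩
    by_contra h
    have h1 : ν b.1 ≤ ν k := hν (le_of_lt (not_le.1 h))
    have h2 : (b.2 : ℕ) < ν b.1 := b.2.2
    have h3 : (b.2 : ℕ) = l := hb.2
    omega

end Fillings

/-! ### LU decomposition of matrices with nonzero leading minors. -/

section LU

variable {K : Type*} [Field K]

/-- All leading principal minors are nonzero. -/
def MinorsNeZero {n : ℕ} (X : Matrix (Fin n) (Fin n) K) : Prop :=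
  ∀ (k : ℕ) (h : k ≤ n), (X.submatrix (Fin.castLE h) (Fin.castLE h)).det ≠ 0

lemma MinorsNeZero.det_ne_zero {n : ℕ} {X : Matrix (Fin n) (Fin n) K} (hX : MinorsNeZero X) :
    X.det ≠ 0 := hX n le_rfl

/-- `LU` decomposition. -/
lemma MinorsNeZero.exists_lu {n : ℕ} (X : Matrix (Fin n) (Fin n) K) (hX : MinorsNeZero X) :
    ∃ L U : Matrix (Fin n) (Fin n) K, (∀ i j, i < j → L i j = 0) ∧ (∀ i j, j < i → U i j = 0) ∧
      (∀ i, U i i = 1) ∧ X = L * U := by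
  induction n with
  | zero => exact ⟨0, 0, fun i => i.elim0, fun i => i.elim0, fun i => i.elim0,
      by ext i; exact i.elim0⟩
  | succ n ih =>
    have hA : MinorsNeZero (X.submatrix Fin.castSucc Fin.castSucc) := fun k h => hX k (by omega)
    obtain ⟨L', U', hL, hU, hU1, hLU⟩ := ih _ hA
    have hdet := hA.det_ne_zero
    rw [hLU, Matrix.det_mul] at hdet
    have hLu : IsUnit L'.det := isUnit_iff_ne_zero.2 (left_ne_zero_of_mul hdet)
    have hUu : IsUnit U'.det := isUnit_iff_ne_zero.2 (right_ne_zero_of_mul hdet)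
    -- Block form: `L' c` must be the last column of `X` and `r U'` its last row, which leaves the
    -- corner of `X` minus `r · c` for the corner of `L`. Only `U` is normalized.
    let c : Fin n → K := L'⁻¹.mulVec fun i => X i.castSucc (Fin.last n)
    let r : Fin n → K := Matrix.vecMul (fun j => X (Fin.last n) j.castSucc) U'⁻¹
    have hc : L'.mulVec c = fun i => X i.castSucc (Fin.last n) := by
      simp only [c, Matrix.mulVec_mulVec, Matrix.mul_nonsing_inv _ hLu, Matrix.one_mulVec]
    have hr : Matrix.vecMul r U' = fun j => X (Fin.last n) j.castSucc := by
      simp only [r, Matrix.vecMul_vecMul, Matrix.nonsing_inv_mul _ hUu, Matrix.vecMul_one]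
    let L : Matrix (Fin (n + 1)) (Fin (n + 1)) K := fun i j =>
      Fin.lastCases (motive := fun _ => K)
        (Fin.lastCases (motive := fun _ => K) (X (Fin.last n) (Fin.last n) - ∑ k, r k * c k) r j)
        (fun i' => Fin.lastCases (motive := fun _ => K) 0 (L' i') j) i
    let U : Matrix (Fin (n + 1)) (Fin (n + 1)) K := fun i j =>
      Fin.lastCases (motive := fun _ => K)
        (Fin.lastCases (motive := fun _ => K) 1 0 j)
        (fun i' => Fin.lastCases (motive := fun _ => K) (c i') (U' i') j) i
    refine ⟨L, U, fun i j hij => ?_, fun i j hij => ?_, fun i => ?_, ?_⟩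
    · refine Fin.lastCases (motive := fun i => i < j → L i j = 0) (fun h => ?_) (fun i h => ?_) i hij
      · exact absurd h (not_lt.2 (Fin.le_last j))
      · refine Fin.lastCases (motive := fun j => i.castSucc < j → L i.castSucc j = 0)
          (fun _ => ?_) (fun j h => ?_) j h
        · simp [L]
        · simpa [L] using hL i j (by simpa using h)
    · refine Fin.lastCases (motive := fun j => j < i → U i j = 0) (fun h => ?_) (fun j h => ?_) j hij
      · exact absurd h (not_lt.2 (Fin.le_last i))
      · refine Fin.lastCases (motive := fun i => j.castSucc < i → U i j.castSucc = 0)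
          (fun _ => ?_) (fun i h => ?_) i h
        · simp [U]
        · simpa [U] using hU i j (by simpa using h)
    · refine Fin.lastCases (motive := fun i => U i i = 1) ?_ (fun i => ?_) i
      · simp [U]
      · simpa [U] using hU1 i
    · ext i j
      rw [Matrix.mul_apply, Fin.sum_univ_castSucc]
      refine Fin.lastCases (motive := fun i => X i j = ∑ k : Fin n, L i k.castSucc * U k.castSucc j +
        L i (Fin.last n) * U (Fin.last n) j) ?_ (fun i => ?_) i
      · refine Fin.lastCases (motive := fun j => X (Fin.last n) j =
          ∑ k : Fin n, L (Fin.last n) k.castSucc * U k.castSucc j +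
          L (Fin.last n) (Fin.last n) * U (Fin.last n) j) ?_ (fun j => ?_) j
        · simp [L, U]
        · have := congr_fun hr j
          simp only [Matrix.vecMul, dotProduct] at this
          simp [L, U, this]
      · refine Fin.lastCases (motive := fun j => X i.castSucc j =
          ∑ k : Fin n, L i.castSucc k.castSucc * U k.castSucc j +
          L i.castSucc (Fin.last n) * U (Fin.last n) j) ?_ (fun j => ?_) j
        · have := congr_fun hc i
          simp only [Matrix.mulVec, dotProduct] at this
          simp [L, U, this]
        · have := congr_fun (congr_fun hLU i) j
          simp only [Matrix.mul_apply, Matrix.submatrix_apply] at this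
          simp [L, U, this]

end LU

/-! ### Row-symmetric tensors as polynomials in the entries of a matrix. -/

section Polarization

variable {m : ℕ} {ν : Fin m → ℕ}

/-- Two fillings with the same row contents differ by a row permutation. -/
lemma exists_rowPerm (S S' : Box ν → Fin m)
    (h : ∀ c : Fin m × Fin m, (Finset.univ.filter fun b => (b.1, S b) = c).card =
      (Finset.univ.filter fun b : Box ν => (b.1, S' b) = c).card) :
    ∃ ρ ∈ rowPerms ν, S = S' ∘ ρ := by
  have e : ∀ c : Fin m × Fin m, Nonempty
      ({b // (fun b : Box ν => (b.1, S b)) b = c} ≃ {b // (fun b : Box ν => (b.1, S' b)) b = c}) := by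
    intro c
    refine ⟨Fintype.equivOfCardEq ?_⟩
    rw [Fintype.card_subtype, Fintype.card_subtype]
    exact h c
  let e := fun c => Classical.choice (e c)
  have h1 := fun b => Equiv.ofFiberEquiv_map e b
  refine ⟨Equiv.ofFiberEquiv e, ?_, ?_⟩
  · simp only [rowPerms, Finset.mem_filter, Finset.mem_univ, true_and]
    exact fun b => congrArg Prod.fst (h1 b)
  · funext b
    exact (congrArg Prod.snd (h1 b)).symm

variable {K : Type*} [Field K] [CharZero K]

/-- The sum is a polynomial in the entries of `X`, and it vanishes on a Zariski dense set. Its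
coefficients are positive multiples of the values of `y`, because fillings give the same monomial
only if they differ by a row permutation. -/
lemma eq_zero_of_row_eval (y : (Box ν → Fin m) → K)
    (hy : ∀ ρ ∈ rowPerms ν, ∀ S, y (S ∘ ρ) = y S)
    (h : ∀ X : Matrix (Fin m) (Fin m) K, MinorsNeZero X →
      ∑ S, (∏ b, X b.1 (S b)) * y S = 0) : y = 0 := by
  classical
  let mon : (Box ν → Fin m) → (Fin m × Fin m →₀ ℕ) := fun S =>
    ∑ b, Finsupp.single (b.1, S b) 1
  let p : MvPolynomial (Fin m × Fin m) K := ∑ S, MvPolynomial.monomial (mon S) (y S)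
  let D : MvPolynomial (Fin m × Fin m) K := ∏ k : Fin (m + 1),
    ((Matrix.mvPolynomialX (Fin m) (Fin m) K).submatrix
      (Fin.castLE (Nat.lt_succ_iff.1 k.2)) (Fin.castLE (Nat.lt_succ_iff.1 k.2))).det
  have hev : ∀ X : Matrix (Fin m) (Fin m) K, ∀ k (hk : k ≤ m),
      MvPolynomial.eval (fun ij : Fin m × Fin m => X ij.1 ij.2)
        (((Matrix.mvPolynomialX (Fin m) (Fin m) K).submatrix (Fin.castLE hk) (Fin.castLE hk)).det) =
      (X.submatrix (Fin.castLE hk) (Fin.castLE hk)).det := by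
    intro X k hk
    rw [RingHom.map_det]
    congr 1
    ext i j
    simp [Matrix.mvPolynomialX_apply]
  have hD : D ≠ 0 := by
    refine Finset.prod_ne_zero_iff.2 fun k _ h0 => ?_
    have h1 := hev 1 k (Nat.lt_succ_iff.1 k.2)
    rw [h0, map_zero, Matrix.submatrix_one _ (Fin.castLE_injective _), Matrix.det_one] at h1
    exact zero_ne_one h1
  have hpe : ∀ X : Matrix (Fin m) (Fin m) K,
      MvPolynomial.eval (fun ij : Fin m × Fin m => X ij.1 ij.2) p =
        ∑ S, (∏ b, X b.1 (S b)) * y S := by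
    intro X
    simp only [p, map_sum, MvPolynomial.eval_monomial]
    refine Finset.sum_congr rfl fun S _ => ?_
    rw [mul_comm]
    congr 1
    simp only [mon]
    refine (Finsupp.prod_finsetSum_index (h := fun (ij : Fin m × Fin m) (n : ℕ) => X ij.1 ij.2 ^ n)
      (fun _ => pow_zero _) (fun _ _ _ => pow_add _ _ _)).symm.trans ?_
    simp
  have hp : p = 0 := by
    -- Where `p` is not known to vanish, some leading minor does, and `D` is the product of the
    -- leading minors.
    have : p * D = 0 := by
      refine MvPolynomial.funext fun x => ?_
      let X : Matrix (Fin m) (Fin m) K := fun i j => x (i, j)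
      have hx : x = fun ij : Fin m × Fin m => X ij.1 ij.2 := rfl
      rw [map_mul, map_zero, mul_eq_zero, hx, hpe]
      by_cases hX : MinorsNeZero X
      · exact Or.inl (h X hX)
      · right
        simp only [MinorsNeZero, not_forall, not_not] at hX
        obtain ⟨k, hk, hX⟩ := hX
        simp only [D, map_prod]
        exact Finset.prod_eq_zero (Finset.mem_univ (⟨k, Nat.lt_succ_iff.2 hk⟩ : Fin (m + 1)))
          ((hev X k hk).trans hX)
    exact (mul_eq_zero.1 this).resolve_right hD
  funext S0
  have hc : MvPolynomial.coeff (mon S0) p = 0 := by rw [hp]; simp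
  simp only [p, MvPolynomial.coeff_sum, MvPolynomial.coeff_monomial] at hc
  have hmon : ∀ S c, mon S c = (Finset.univ.filter fun b : Box ν => (b.1, S b) = c).card := by
    intro S c
    simp [mon, Finsupp.finsetSum_apply, Finsupp.single_apply]
  have h3 : ∀ S, (if mon S = mon S0 then y S else 0) = if mon S = mon S0 then y S0 else 0 := by
    intro S
    split_ifs with hS
    · obtain ⟨ρ, hρ, rfl⟩ := exists_rowPerm S S0 fun c => by rw [← hmon, ← hmon, hS]
      exact hy ρ hρ S0
    · rfl
  rw [Finset.sum_congr rfl fun S _ => h3 S, Finset.sum_ite, Finset.sum_const, Finset.sum_const_zero,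
    add_zero, nsmul_eq_mul, mul_eq_zero] at hc
  refine hc.resolve_left ?_
  exact fun h0 => (Finset.card_pos.2 ⟨S0, by simp⟩).ne' (Nat.cast_eq_zero.1 h0)

end Polarization

/-! ### Tensor coordinates of the Young symmetrizer and of the group action. -/

section Coordinates

variable {K : Type*} [Field K] {E : Type*} [AddCommGroup E] [Module K E] {m : ℕ}
  (b : Module.Basis (Fin m) K E) {ν : Fin m → ℕ}

/-- The basis of the tensor power indexed by fillings. -/
noncomputable def tBasis (ν : Fin m → ℕ) : Module.Basis (Box ν → Fin m) K (BoxTensor K E ν) :=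
  Basis.piTensorProduct fun _ => b

lemma tBasis_apply (S : Box ν → Fin m) :
    tBasis b ν S = PiTensorProduct.tprod K fun c => b (S c) :=
  Basis.piTensorProduct_apply _ _

/-- The coordinate of a tensor at a filling. -/
noncomputable def tcoord (x : BoxTensor K E ν) (S : Box ν → Fin m) : K := (tBasis b ν).repr x S

lemma tcoord_tprod (v : Box ν → E) (S : Box ν → Fin m) :
    tcoord b (PiTensorProduct.tprod K v) S = ∏ c, b.repr (v c) (S c) :=
  Basis.piTensorProduct_repr_tprod_apply _ _ _

lemma tcoord_ext {x y : BoxTensor K E ν} (h : ∀ S, tcoord b x S = tcoord b y S) : x = y :=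
  (tBasis b ν).ext_elem h

lemma tcoord_add (x y : BoxTensor K E ν) : tcoord b (x + y) = tcoord b x + tcoord b y := by
  funext S; simp [tcoord]

lemma tcoord_smul (a : K) (x : BoxTensor K E ν) : tcoord b (a • x) = a • tcoord b x := by
  funext S; simp [tcoord]

lemma tcoord_zero : tcoord b (0 : BoxTensor K E ν) = 0 := by
  funext S; simp [tcoord]

lemma tcoord_sum {ι : Type*} (s : Finset ι) (x : ι → BoxTensor K E ν) (S : Box ν → Fin m) :
    tcoord b (∑ i ∈ s, x i) S = ∑ i ∈ s, tcoord b (x i) S := by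
  simp [tcoord, Finsupp.finsetSum_apply]

lemma tcoord_tBasis [DecidableEq (Box ν → Fin m)] (R S : Box ν → Fin m) :
    tcoord b (tBasis b ν R) S = if R = S then 1 else 0 := by
  simp [tcoord, Finsupp.single_apply]

lemma sum_tcoord_smul (x : BoxTensor K E ν) : ∑ S, tcoord b x S • tBasis b ν S = x :=
  (tBasis b ν).sum_repr x

lemma permAct_tprod (σ : Equiv.Perm (Box ν)) (v : Box ν → E) :
    permAct K E ν σ (PiTensorProduct.tprod K v) = PiTensorProduct.tprod K (v ∘ σ.symm) :=
  PiTensorProduct.reindex_tprod σ v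

lemma permAct_tBasis (σ : Equiv.Perm (Box ν)) (S : Box ν → Fin m) :
    permAct K E ν σ (tBasis b ν S) = tBasis b ν (S ∘ σ.symm) := by
  rw [tBasis_apply, permAct_tprod, tBasis_apply]
  rfl

lemma tcoord_permAct (σ : Equiv.Perm (Box ν)) (x : BoxTensor K E ν) (S : Box ν → Fin m) :
    tcoord b (permAct K E ν σ x) S = tcoord b x (S ∘ σ) := by
  classical
  induction x using PiTensorProduct.induction_on with
  | smul_tprod r v =>
    rw [map_smul, tcoord_smul, tcoord_smul, permAct_tprod, Pi.smul_apply, Pi.smul_apply,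
      tcoord_tprod, tcoord_tprod]
    congr 1
    exact Fintype.prod_equiv σ.symm _ _ fun c => by simp
  | add x y hx hy => rw [map_add, tcoord_add, tcoord_add, Pi.add_apply, Pi.add_apply, hx, hy]

/-- Symmetrization along the rows. -/
noncomputable def rowSym (K : Type*) [Field K] (E : Type*) [AddCommGroup E] [Module K E]
    (ν : Fin m → ℕ) : BoxTensor K E ν →ₗ[K] BoxTensor K E ν :=
  ∑ σ ∈ rowPerms ν, permAct K E ν σ

/-- Antisymmetrization along the columns. -/
noncomputable def colAlt (K : Type*) [Field K] (E : Type*) [AddCommGroup E] [Module K E]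
    (ν : Fin m → ℕ) : BoxTensor K E ν →ₗ[K] BoxTensor K E ν :=
  ∑ σ ∈ colPerms ν, ((Equiv.Perm.sign σ : ℤ) : K) • permAct K E ν σ

lemma youngSymmetrizer_apply (x : BoxTensor K E ν) :
    youngSymmetrizer K E ν x = colAlt K E ν (rowSym K E ν x) := rfl

lemma tcoord_rowSym (x : BoxTensor K E ν) :
    tcoord b (rowSym K E ν x) = permSum (rowPerms ν) (fun _ => 1) (tcoord b x) := by
  funext S
  simp [rowSym, LinearMap.sum_apply, tcoord_sum, permSum, tcoord_permAct]

lemma tcoord_colAlt (x : BoxTensor K E ν) :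
    tcoord b (colAlt K E ν x) =
      permSum (colPerms ν) (fun σ => (Equiv.Perm.sign σ : ℤ)) (tcoord b x) := by
  funext S
  simp only [colAlt, LinearMap.sum_apply, tcoord_sum, permSum, LinearMap.smul_apply, tcoord_smul,
    Pi.smul_apply, tcoord_permAct, smul_eq_mul, zsmul_eq_mul]

lemma colAlt_comp (x : BoxTensor K E ν) {τ : Equiv.Perm (Box ν)} (hτ : τ ∈ colPerms ν)
    (S : Box ν → Fin m) : tcoord b (colAlt K E ν x) (S ∘ τ) =
      ((Equiv.Perm.sign τ : ℤ) : K) * tcoord b (colAlt K E ν x) S := by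
  rw [tcoord_colAlt, permSum_comp (colPerms_isSigned ν) hτ, zsmul_eq_mul]

lemma rowSym_of_comp (x : BoxTensor K E ν)
    (hx : ∀ τ ∈ rowPerms ν, ∀ S, tcoord b x (S ∘ τ) = tcoord b x S) :
    rowSym K E ν x = ((rowPerms ν).card : K) • x := by
  refine tcoord_ext b fun S => ?_
  rw [tcoord_rowSym, permSum_of_comp (rowPerms_isSigned ν) _ _ (fun τ hτ => by simp [hx τ hτ]),
    tcoord_smul]
  simp

lemma colAlt_of_comp (x : BoxTensor K E ν)
    (hx : ∀ τ ∈ colPerms ν, ∀ S, tcoord b x (S ∘ τ) = ((Equiv.Perm.sign τ : ℤ) : K) * tcoord b x S) :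
    colAlt K E ν x = ((colPerms ν).card : K) • x := by
  refine tcoord_ext b fun S => ?_
  rw [tcoord_colAlt, permSum_of_comp (colPerms_isSigned ν) _ _ (fun τ hτ => by simp [hx τ hτ]),
    tcoord_smul]
  simp

/-- Transposing two equal entries of a column fixes the filling and negates the coordinate. -/
lemma tcoord_colAlt_eq_zero [CharZero K] (x : BoxTensor K E ν) {S : Box ν → Fin m}
    (hS : ¬ ColInj S) : tcoord b (colAlt K E ν x) S = 0 := by
  simp only [ColInj, not_forall] at hS
  obtain ⟨c, c', h1, h2, h3⟩ := hS
  have hτ : Equiv.swap c c' ∈ colPerms ν := by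
    simp only [colPerms, Finset.mem_filter, Finset.mem_univ, true_and]
    intro d
    rcases eq_or_ne d c with rfl | hd
    · rw [Equiv.swap_apply_left, h1]
    rcases eq_or_ne d c' with rfl | hd'
    · rw [Equiv.swap_apply_right, h1]
    · rw [Equiv.swap_apply_of_ne_of_ne hd hd']
  have h := colAlt_comp b x hτ S
  have hSS : S ∘ Equiv.swap c c' = S := by
    funext d
    rcases eq_or_ne d c with rfl | hd
    · simp [h2]
    rcases eq_or_ne d c' with rfl | hd'
    · simp [h2]
    · simp [Equiv.swap_apply_of_ne_of_ne hd hd']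
  rw [hSS, Equiv.Perm.sign_swap h3] at h
  simp only [Units.val_neg, Units.val_one, Int.cast_neg, Int.cast_one, neg_mul, one_mul] at h
  exact self_eq_neg.1 h

lemma colAlt_tBasis_eq_zero [CharZero K] {R : Box ν → Fin m} (hR : ¬ ColInj R) :
    colAlt K E ν (tBasis b ν R) = 0 := by
  classical
  refine tcoord_ext b fun S => ?_
  by_cases hS : ∃ σ ∈ colPerms ν, R = S ∘ σ
  · obtain ⟨σ, hσ, rfl⟩ := hS
    rw [tcoord_colAlt_eq_zero, tcoord_zero, Pi.zero_apply]
    intro hS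
    refine hR fun c c' h1 h2 => ?_
    have hσ' : ∀ c, ((σ c).2 : ℕ) = c.2 := by simpa [colPerms] using hσ
    exact σ.injective (hS _ _ ((hσ' c).trans (h1.trans (hσ' c').symm)) h2)
  · rw [tcoord_colAlt, tcoord_zero, permSum]
    refine Finset.sum_eq_zero fun σ hσ => ?_
    rw [tcoord_tBasis, if_neg fun h => hS ⟨σ, hσ, h⟩, smul_zero]

/-- With `r`, `c` the row and column sums, `r c r x = 0` implies `c r x = 0`: a vector of the Schur
module can be tested for zero after row symmetrization. -/
lemma rowSym_eq_zero_of_colAlt [CharZero K] (b : Module.Basis (Fin m) K E) {x : BoxTensor K E ν}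
    (h : rowSym K E ν (youngSymmetrizer K E ν x) = 0) : youngSymmetrizer K E ν x = 0 := by
  refine tcoord_ext b fun S => ?_
  have h0 : tcoord b (rowSym K E ν (youngSymmetrizer K E ν x)) = 0 := by rw [h, tcoord_zero]
  rw [youngSymmetrizer_apply, tcoord_rowSym, tcoord_colAlt, tcoord_rowSym] at h0
  rw [youngSymmetrizer_apply, tcoord_colAlt, tcoord_rowSym,
    permSum_eq_zero (rowPerms_isSigned ν) (colPerms_isSigned ν) _ h0, tcoord_zero]

/-- The mirror statement `c r c x = 0 ⇒ r c x = 0`, needed for the nonvanishing of Pieri maps. -/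
lemma rowSym_colAlt_eq_zero [CharZero K] (b : Module.Basis (Fin m) K E) {x : BoxTensor K E ν}
    (h : youngSymmetrizer K E ν (colAlt K E ν x) = 0) : rowSym K E ν (colAlt K E ν x) = 0 := by
  refine tcoord_ext b fun S => ?_
  have h0 : tcoord b (youngSymmetrizer K E ν (colAlt K E ν x)) = 0 := by rw [h, tcoord_zero]
  rw [youngSymmetrizer_apply, tcoord_colAlt, tcoord_rowSym, tcoord_colAlt] at h0
  rw [tcoord_rowSym, tcoord_colAlt,
    permSum_eq_zero (colPerms_isSigned ν) (rowPerms_isSigned ν) _ h0, tcoord_zero]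

/-- The element of `GL(E)` with a given matrix. -/
noncomputable def matGL (X : Matrix (Fin m) (Fin m) K) (hX : X.det ≠ 0) : GLin K E :=
  Units.map (Matrix.toLinAlgEquiv b).toMonoidHom
    (Matrix.nonsingInvUnit X (isUnit_iff_ne_zero.2 hX))

lemma matGL_coe (X : Matrix (Fin m) (Fin m) K) (hX : X.det ≠ 0) :
    (matGL b X hX : E →ₗ[K] E) = Matrix.toLin b b X := rfl

lemma repr_matGL (X : Matrix (Fin m) (Fin m) K) (hX : X.det ≠ 0) (i j : Fin m) :
    b.repr ((matGL b X hX : E →ₗ[K] E) (b j)) i = X i j := by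
  rw [matGL_coe, Matrix.toLin_self]
  simp [Finsupp.single_apply]

lemma matGL_mul (X Y : Matrix (Fin m) (Fin m) K) (hX : X.det ≠ 0) (hY : Y.det ≠ 0)
    (hXY : (X * Y).det ≠ 0) : matGL b (X * Y) hXY = matGL b X hX * matGL b Y hY := by
  refine Units.ext ?_
  rw [Units.val_mul, matGL_coe, matGL_coe, matGL_coe, Matrix.toLin_mul b b b]
  rfl

lemma tcoord_tensorRep (X : Matrix (Fin m) (Fin m) K) (hX : X.det ≠ 0) (x : BoxTensor K E ν)
    (S : Box ν → Fin m) : tcoord b (tensorRep K E ν (matGL b X hX) x) S =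
      ∑ R, (∏ c, X (S c) (R c)) * tcoord b x R := by
  conv_lhs => rw [← sum_tcoord_smul b x, map_sum, tcoord_sum]
  refine Finset.sum_congr rfl fun R _ => ?_
  rw [map_smul, tcoord_smul, Pi.smul_apply, smul_eq_mul, mul_comm, tBasis_apply]
  congr 1
  have h : tensorRep K E ν (matGL b X hX) (PiTensorProduct.tprod K fun c => b (R c)) =
      PiTensorProduct.tprod K fun c => (matGL b X hX : E →ₗ[K] E) (b (R c)) :=
    PiTensorProduct.map_tprod _ _
  rw [h, tcoord_tprod]
  simp only [repr_matGL]

end Coordinates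

/-! ### Highest weight vectors and their dual functionals. -/

section HighestWeight

variable {K : Type*} [Field K] {E : Type*} [AddCommGroup E] [Module K E] {m : ℕ}
  (b : Module.Basis (Fin m) K E) {ν : Fin m → ℕ}

lemma schurRep_coe (g : GLin K E) (x : SchurModule K E ν) :
    (schurRep K E ν g x : BoxTensor K E ν) = tensorRep K E ν g x := rfl

/-- The highest weight vector of `S_ν E`. -/
noncomputable def hwVec (ν : Fin m → ℕ) : SchurModule K E ν :=
  ⟨youngSymmetrizer K E ν (tBasis b ν (rowFill ν)), _, rfl⟩

/-- The functional on `S_ν E` dual to the highest weight vector. -/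
noncomputable def hwCoord (ν : Fin m → ℕ) : SchurModule K E ν →ₗ[K] K :=
  (tBasis b ν).coord (rowFill ν) ∘ₗ (LinearMap.range (youngSymmetrizer K E ν)).subtype

lemma hwCoord_apply (x : SchurModule K E ν) :
    hwCoord b ν x = tcoord b (x : BoxTensor K E ν) (rowFill ν) := rfl

variable [CharZero K]

lemma schur_tcoord_eq_zero (x : SchurModule K E ν) {S : Box ν → Fin m} (hS : ¬ ColInj S) :
    tcoord b (x : BoxTensor K E ν) S = 0 := by
  obtain ⟨_, y, rfl⟩ := x
  exact tcoord_colAlt_eq_zero b _ hS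

/-- Row permutations preserve the bound `R c ≤ c.1`. Among the fillings with this bound only
`rowFill` is injective on columns, so column antisymmetrization kills every summand. -/
lemma youngSymmetrizer_tBasis_eq_zero (hν : Antitone ν) {R : Box ν → Fin m}
    (hle : ∀ c, R c ≤ c.1) (hR : R ≠ rowFill ν) : youngSymmetrizer K E ν (tBasis b ν R) = 0 := by
  rw [youngSymmetrizer_apply, rowSym, LinearMap.sum_apply, map_sum]
  refine Finset.sum_eq_zero fun ρ hρ => ?_
  rw [permAct_tBasis]
  refine colAlt_tBasis_eq_zero b fun h => hR ?_
  have hρ' : ∀ c, (ρ c).1 = c.1 := by simpa [rowPerms] using hρ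
  have hs : ∀ c, (ρ.symm c).1 = c.1 := fun c => by
    have := hρ' (ρ.symm c)
    rw [Equiv.apply_symm_apply] at this
    exact this.symm
  have h1 := h.eq_rowFill hν fun c => (hle (ρ.symm c)).trans_eq (hs c)
  funext c
  have h2 := congr_fun h1 (ρ c)
  simp only [Function.comp_apply, Equiv.symm_apply_apply] at h2
  rw [h2]
  exact hρ' c

/-- An upper triangular matrix moves the basis tensor of `rowFill` into the span of the `R` with `R
c ≤ c.1`, of which only `rowFill` survives the Young symmetrizer. -/
lemma schurRep_hwVec (hν : Antitone ν) (X : Matrix (Fin m) (Fin m) K) (hX : X.det ≠ 0)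
    (hup : ∀ i j, j < i → X i j = 0) :
    schurRep K E ν (matGL b X hX) (hwVec b ν) = (∏ c : Box ν, X c.1 c.1) • hwVec b ν := by
  refine Subtype.ext ?_
  rw [schurRep_coe, hwVec, tensorRep_youngSymmetrizer, Submodule.coe_smul]
  conv_lhs => rw [← sum_tcoord_smul b (tensorRep K E ν (matGL b X hX) (tBasis b ν (rowFill ν))),
    map_sum]
  classical
  have hc : ∀ R : Box ν → Fin m, tcoord b
      (tensorRep K E ν (matGL b X hX) (tBasis b ν (rowFill ν))) R = ∏ c, X (R c) c.1 := by
    intro R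
    rw [tcoord_tensorRep]
    simp [tcoord_tBasis, rowFill]
  rw [Finset.sum_eq_single (rowFill ν)]
  · rw [map_smul, hc]
    rfl
  · intro R _ hR
    rw [map_smul, hc]
    by_cases hle : ∀ c, R c ≤ c.1
    · rw [youngSymmetrizer_tBasis_eq_zero b hν hle hR, smul_zero]
    · push Not at hle
      obtain ⟨c, hc⟩ := hle
      rw [Finset.prod_eq_zero (Finset.mem_univ c) (hup _ _ hc), zero_smul]
  · intro h
    exact absurd (Finset.mem_univ _) h

/-- Dual to `schurRep_hwVec`: for lower triangular matrices only coordinates at `R` with `R c ≤ c.1`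
contribute, and those of a vector of the Schur module vanish unless `R = rowFill ν`. -/
lemma hwCoord_schurRep (hν : Antitone ν) (X : Matrix (Fin m) (Fin m) K) (hX : X.det ≠ 0)
    (hlow : ∀ i j, i < j → X i j = 0) (x : SchurModule K E ν) :
    hwCoord b ν (schurRep K E ν (matGL b X hX) x) = (∏ c : Box ν, X c.1 c.1) * hwCoord b ν x := by
  rw [hwCoord_apply, schurRep_coe, tcoord_tensorRep, Finset.sum_eq_single (rowFill ν)]
  · rfl
  · intro R _ hR
    by_cases hle : ∀ c, R c ≤ c.1
    · rw [schur_tcoord_eq_zero b x fun h => hR (h.eq_rowFill hν hle), mul_zero]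
    · push Not at hle
      obtain ⟨c, hc⟩ := hle
      rw [Finset.prod_eq_zero (Finset.mem_univ c) (hlow (rowFill ν c) (R c) hc), zero_mul]
  · intro h
    exact absurd (Finset.mem_univ _) h

/-- `S_ν E` is generated by its highest weight vector. -/
lemma eq_zero_of_hwVec_dual (ℓ : SchurModule K E ν →ₗ[K] K)
    (h : ∀ g, ℓ (schurRep K E ν g (hwVec b ν)) = 0) : ℓ = 0 := by
  classical
  let L : BoxTensor K E ν →ₗ[K] K := ℓ ∘ₗ (youngSymmetrizer K E ν).rangeRestrict
  have hL : (fun S => L (tBasis b ν S)) = 0 := by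
    refine eq_zero_of_row_eval _ (fun ρ hρ S => ?_) fun X hX => ?_
    · have e : youngSymmetrizer K E ν (tBasis b ν (S ∘ ρ)) =
          youngSymmetrizer K E ν (tBasis b ν S) := by
        rw [youngSymmetrizer_apply, youngSymmetrizer_apply]
        congr 1
        refine tcoord_ext b fun R => ?_
        rw [tcoord_rowSym, tcoord_rowSym, permSum, permSum,
          ← (rowPerms_isSigned ν).sum_mul_right hρ]
        refine Finset.sum_congr rfl fun σ _ => ?_
        rw [tcoord_tBasis, tcoord_tBasis]
        congr 2
        simp only [eq_iff_iff]
        constructor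
        · rintro h
          funext c
          have := congr_fun h (ρ.symm c)
          simpa using this
        · rintro h
          rw [h]
          rfl
      simp only [L, LinearMap.comp_apply]
      congr 1
      exact Subtype.ext e
    · have hdet : X.transpose.det ≠ 0 := by rw [Matrix.det_transpose]; exact hX.det_ne_zero
      -- The transpose appears because the coordinate of `g · tBasis b ν (rowFill ν)` at `S` is the
      -- product of the entries of `g` at `(S c, c.1)`.
      have h1 := h (matGL b X.transpose hdet)
      have h2 : schurRep K E ν (matGL b X.transpose hdet) (hwVec b ν) =
          (youngSymmetrizer K E ν).rangeRestrict
            (tensorRep K E ν (matGL b X.transpose hdet) (tBasis b ν (rowFill ν))) :=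
        Subtype.ext (tensorRep_youngSymmetrizer K E ν _ _)
      rw [h2, ← sum_tcoord_smul b (tensorRep K E ν (matGL b X.transpose hdet) _)] at h1
      simp only [map_sum, map_smul, smul_eq_mul, tcoord_tensorRep, tcoord_tBasis] at h1
      rw [← h1]
      refine Finset.sum_congr rfl fun S _ => ?_
      rw [Finset.sum_eq_single (rowFill ν) (fun R _ hR => by rw [if_neg hR.symm, mul_zero])
        (fun h => absurd (Finset.mem_univ _) h), if_pos rfl, mul_one]
      rfl
  have hL0 : L = 0 := (tBasis b ν).ext fun S => congr_fun hL S
  ext ⟨_, y, rfl⟩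
  exact LinearMap.congr_fun hL0 y

lemma eq_zero_of_hwVec {M : Type*} [AddCommGroup M] [Module K M] (f : SchurModule K E ν →ₗ[K] M)
    (h : ∀ g, f (schurRep K E ν g (hwVec b ν)) = 0) : f = 0 := by
  ext1 x
  refine (Module.forall_dual_apply_eq_zero_iff K _).1 fun θ => ?_
  have := eq_zero_of_hwVec_dual b (θ ∘ₗ f) fun g => by simp [h g]
  exact LinearMap.congr_fun this x

/-- The highest weight coordinates of the translates of a vector by the upper unipotent group
determine the vector. -/
lemma eq_zero_of_hwCoord (hν : Antitone ν) (x : SchurModule K E ν)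
    (h : ∀ (X : Matrix (Fin m) (Fin m) K) (hX : X.det ≠ 0), (∀ i j, j < i → X i j = 0) →
      (∀ i, X i i = 1) → hwCoord b ν (schurRep K E ν (matGL b X hX) x) = 0) : x = 0 := by
  classical
  -- For `X = L U`, the polynomial attached to `rowSym x` takes at `X` a multiple of the highest
  -- weight coordinate of `X x`. There `L` acts by a scalar and `U` is covered by the hypothesis.
  have key : tcoord b (rowSym K E ν (x : BoxTensor K E ν)) = 0 := by
    refine eq_zero_of_row_eval _ (fun ρ hρ S => ?_) fun X hX => ?_
    · rw [tcoord_rowSym, permSum_comp (rowPerms_isSigned ν) hρ, one_smul]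
    · obtain ⟨L, U, hL, hU, hU1, rfl⟩ := hX.exists_lu
      have hd := hX.det_ne_zero
      have hd' := hd
      rw [Matrix.det_mul] at hd'
      have hLd := left_ne_zero_of_mul hd'
      have hUd := right_ne_zero_of_mul hd'
      have h1 : hwCoord b ν (schurRep K E ν (matGL b (L * U) hd) x) = 0 := by
        rw [matGL_mul b L U hLd hUd, map_mul, Module.End.mul_apply, hwCoord_schurRep b hν _ _ hL,
          h U hUd hU hU1, mul_zero]
      rw [hwCoord_apply, schurRep_coe, tcoord_tensorRep] at h1
      rw [tcoord_rowSym]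
      have h2 : ∀ S : Box ν → Fin m, ∏ c, (L * U) c.1 (S c) =
          ∏ c, (L * U) (rowFill ν c) (S c) := fun _ => rfl
      simp only [h2]
      rw [← sum_permSum_mul (rowPerms_isSigned ν)]
      have h3 : permSum (rowPerms ν) (fun _ => 1) (fun S => ∏ c, (L * U) (rowFill ν c) (S c)) =
          fun S => ((rowPerms ν).card : K) * ∏ c, (L * U) (rowFill ν c) (S c) := by
        funext S
        rw [permSum_of_comp (rowPerms_isSigned ν)]
        · simp
        · intro τ hτ
          have hτ' : ∀ c, (τ c).1 = c.1 := by simpa [rowPerms] using hτ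
          rw [one_smul]
          exact Fintype.prod_equiv τ _ _ fun c => by simp [rowFill, hτ']
      rw [h3]
      simp only [mul_assoc]
      rw [← Finset.mul_sum, h1, mul_zero]
  obtain ⟨_, y, rfl⟩ := x
  refine Subtype.ext (rowSym_eq_zero_of_colAlt b (tcoord_ext b fun S => ?_))
  rw [tcoord_zero]
  exact congr_fun key S

end HighestWeight

/-! ### Contracting one factor of a tensor product with a functional. -/

section Contraction

variable {K : Type*} [Field K] {A V : Type*} [AddCommGroup A] [Module K A] [AddCommGroup V]
  [Module K V]

/-- Apply a functional to the first tensor factor. -/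
noncomputable def contractLeft (θ : A →ₗ[K] K) : A ⊗[K] V →ₗ[K] V :=
  (TensorProduct.lid K V).toLinearMap ∘ₗ LinearMap.rTensor V θ

/-- Apply a functional to the second tensor factor. -/
noncomputable def contractRight (ξ : V →ₗ[K] K) : A ⊗[K] V →ₗ[K] A :=
  (TensorProduct.rid K A).toLinearMap ∘ₗ LinearMap.lTensor A ξ

@[simp] lemma contractLeft_tmul (θ : A →ₗ[K] K) (a : A) (x : V) :
    contractLeft θ (a ⊗ₜ[K] x) = θ a • x := by simp [contractLeft]

@[simp] lemma contractRight_tmul (ξ : V →ₗ[K] K) (a : A) (x : V) :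
    contractRight ξ (a ⊗ₜ[K] x) = ξ x • a := by simp [contractRight]

lemma contractLeft_map (θ : A →ₗ[K] K) (α : A →ₗ[K] A) (β : V →ₗ[K] V) (w : A ⊗[K] V) :
    contractLeft θ (TensorProduct.map α β w) = β (contractLeft (θ ∘ₗ α) w) := by
  induction w using TensorProduct.induction_on with
  | zero => simp
  | tmul a x => simp
  | add x y hx hy => simp only [map_add, hx, hy]

lemma contractRight_map (ξ : V →ₗ[K] K) (α : A →ₗ[K] A) (β : V →ₗ[K] V) (w : A ⊗[K] V) :
    contractRight ξ (TensorProduct.map α β w) = α (contractRight (ξ ∘ₗ β) w) := by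
  induction w using TensorProduct.induction_on with
  | zero => simp
  | tmul a x => simp
  | add x y hx hy => simp only [map_add, hx, hy]

/-- Contractions of the two factors commute; this carries vanishing back and forth between
polynomials and vectors of the Schur module. -/
lemma apply_contractRight (θ : A →ₗ[K] K) (ξ : V →ₗ[K] K) (w : A ⊗[K] V) :
    θ (contractRight ξ w) = ξ (contractLeft θ w) := by
  induction w using TensorProduct.induction_on with
  | zero => simp
  | tmul a x => simp [mul_comm]
  | add x y hx hy => simp only [map_add, hx, hy]

lemma eq_zero_of_contractLeft {w : A ⊗[K] V} (h : ∀ θ : A →ₗ[K] K, contractLeft θ w = 0) :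
    w = 0 := by
  let bA := Module.Free.chooseBasis K A
  let bV := Module.Free.chooseBasis K V
  refine (bA.tensorProduct bV).ext_elem fun ⟨i, j⟩ => ?_
  have h1 : ∀ w, (bA.tensorProduct bV).repr w (i, j) = bV.coord j (contractLeft (bA.coord i) w) := by
    intro w
    induction w using TensorProduct.induction_on with
    | zero => simp
    | tmul a x => simp [mul_comm]
    | add x y hx hy => simp only [map_add, Finsupp.add_apply, hx, hy]
  rw [h1, h, map_zero, map_zero, Finsupp.zero_apply]

end Contraction

/-! ### The diagonal torus, its weights, and `Sym E` as a polynomial ring. -/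

section Torus

variable {K : Type*} [Field K] {E : Type*} [AddCommGroup E] [Module K E] {m : ℕ}
  (b : Module.Basis (Fin m) K E) {ν : Fin m → ℕ}

lemma det_diagonal_ne_zero {t : Fin m → K} (ht : ∀ j, t j ≠ 0) : (Matrix.diagonal t).det ≠ 0 := by
  rw [Matrix.det_diagonal]
  exact Finset.prod_ne_zero_iff.2 fun j _ => ht j

/-- The element of the diagonal torus with given entries. -/
noncomputable def torusGL (t : Fin m → K) (ht : ∀ j, t j ≠ 0) : GLin K E :=
  matGL b (Matrix.diagonal t) (det_diagonal_ne_zero ht)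

lemma prod_box (t : Fin m → K) : ∏ c : Box ν, t c.1 = ∏ j, t j ^ ν j := by
  rw [Fintype.prod_sigma]
  simp

lemma torusGL_apply (t : Fin m → K) (ht : ∀ j, t j ≠ 0) (j : Fin m) :
    (torusGL b t ht : E →ₗ[K] E) (b j) = t j • b j := by
  rw [torusGL, matGL_coe, Matrix.toLin_self,
    Finset.sum_eq_single j (fun i _ hi => by rw [Matrix.diagonal_apply_ne _ hi, zero_smul])
      (fun h => absurd (Finset.mem_univ _) h), Matrix.diagonal_apply_eq]

lemma tcoord_torus (t : Fin m → K) (ht : ∀ j, t j ≠ 0) (x : BoxTensor K E ν) (S : Box ν → Fin m) :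
    tcoord b (tensorRep K E ν (torusGL b t ht) x) S = (∏ c, t (S c)) * tcoord b x S := by
  rw [torusGL, tcoord_tensorRep, Finset.sum_eq_single S]
  · simp
  · intro R _ hR
    obtain ⟨c, hc⟩ := Function.ne_iff.1 hR
    have h0 : Matrix.diagonal t (S c) (R c) = 0 := Matrix.diagonal_apply_ne _ hc.symm
    rw [Finset.prod_eq_zero (Finset.mem_univ c) h0, zero_mul]
  · exact fun h => absurd (Finset.mem_univ _) h

/-- A point of the torus which is `2` at one place and `1` elsewhere. -/
def twoAt (K : Type*) [Field K] (j : Fin m) : Fin m → K := Function.update 1 j 2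

lemma twoAt_ne_zero [CharZero K] (j i : Fin m) : twoAt K j i ≠ 0 := by
  unfold twoAt
  rcases eq_or_ne i j with rfl | h
  · simp
  · simp [Function.update_of_ne h]

lemma prod_twoAt_pow (j : Fin m) (n : Fin m → ℕ) : ∏ i, twoAt K j i ^ n i = 2 ^ n j := by
  rw [Finset.prod_eq_single j]
  · simp [twoAt]
  · intro i _ hi
    simp [twoAt, Function.update_of_ne hi]
  · exact fun h => absurd (Finset.mem_univ _) h

/-- In characteristic `0` the single value `2` in one coordinate already separates the weights of
that coordinate. -/
lemma two_pow_inj [CharZero K] {p q : ℕ} (h : (2 : K) ^ p = 2 ^ q) : p = q := by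
  have h' : ((2 ^ p : ℕ) : K) = (2 ^ q : ℕ) := by exact_mod_cast h
  exact Nat.pow_right_injective le_rfl (Nat.cast_injective h')

/-- The identification of `Sym E` with the polynomial ring. -/
noncomputable def toPoly : PolyRing K E ≃ₐ[K] MvPolynomial (Fin m) K :=
  SymmetricAlgebra.equivMvPolynomial b

lemma toPoly_ι (j : Fin m) : toPoly b (SymmetricAlgebra.ι K E (b j)) = MvPolynomial.X j :=
  SymmetricAlgebra.equivMvPolynomial_ι_apply b j

lemma eq_zero_of_toPoly {a : PolyRing K E} (h : toPoly b a = 0) : a = 0 :=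
  (toPoly b).injective (h.trans (map_zero _).symm)

lemma symMap_ι (g : GLin K E) (x : E) :
    symMap K E g (SymmetricAlgebra.ι K E x) = SymmetricAlgebra.ι K E ((g : E →ₗ[K] E) x) := by
  simp [symMap]

lemma coeff_aeval_smul_X (t : Fin m → K) (p : MvPolynomial (Fin m) K) (n : Fin m →₀ ℕ) :
    (MvPolynomial.aeval (fun j => t j • (MvPolynomial.X j : MvPolynomial (Fin m) K)) p).coeff n =
      (∏ j, t j ^ n j) * p.coeff n := by
  induction p using MvPolynomial.induction_on' with
  | monomial u a =>
    have h : MvPolynomial.aeval (fun j => t j • (MvPolynomial.X j : MvPolynomial (Fin m) K))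
        (MvPolynomial.monomial u a) = MvPolynomial.monomial u ((∏ j, t j ^ u j) * a) := by
      rw [MvPolynomial.aeval_monomial, Finsupp.prod_fintype _ _ (fun _ => pow_zero _)]
      simp only [smul_pow, Finset.prod_smul]
      rw [MvPolynomial.monomial_eq, Finsupp.prod_fintype _ _ (fun _ => pow_zero _),
        MvPolynomial.algebraMap_eq, MvPolynomial.C_mul, MvPolynomial.smul_eq_C_mul]
      ring
    rw [h, MvPolynomial.coeff_monomial, MvPolynomial.coeff_monomial]
    split_ifs with hu
    · rw [hu]
    · simp
  | add p q hp hq => rw [map_add, MvPolynomial.coeff_add, hp, hq, MvPolynomial.coeff_add, mul_add]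

lemma toPoly_symMap_torus (t : Fin m → K) (ht : ∀ j, t j ≠ 0) (a : PolyRing K E) :
    toPoly b (symMap K E (torusGL b t ht) a) =
      MvPolynomial.aeval (fun j => t j • (MvPolynomial.X j : MvPolynomial (Fin m) K))
        (toPoly b a) := by
  have h : (toPoly b).toAlgHom.comp (symMap K E (torusGL b t ht)) =
      (MvPolynomial.aeval (fun j => t j • (MvPolynomial.X j : MvPolynomial (Fin m) K))).comp
        (toPoly b).toAlgHom := by
    refine SymmetricAlgebra.algHom_ext (b.ext fun j => ?_)
    simp [symMap_ι, torusGL_apply, toPoly_ι]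
  exact DFunLike.congr_fun h a

lemma symMap_injective (g : GLin K E) {a : PolyRing K E} (h : symMap K E g a = 0) : a = 0 := by
  have h1 : symMap K E g⁻¹ (symMap K E g a) = a := (symRep K E).inv_self_apply g a
  rw [← h1, h, map_zero]

end Torus

/-! ### Pieri's rule: multiplicity one and vanishing. -/

section EquivariantMaps

variable {K : Type*} [Field K] {E : Type*} [AddCommGroup E] [Module K E] {m : ℕ}
  (b : Module.Basis (Fin m) K E) {μ ν : Fin m → ℕ}

/-- A linear map `S_ν E → Sym E ⊗ S_μ E` is equivariant. -/
def IsEquivariant (f : SchurModule K E ν →ₗ[K] PolyRing K E ⊗[K] SchurModule K E μ) : Prop :=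
  ∀ g x, f (schurRep K E ν g x) =
    TensorProduct.map (symMap K E g).toLinearMap (schurRep K E μ g) (f x)

variable {f : SchurModule K E ν →ₗ[K] PolyRing K E ⊗[K] SchurModule K E μ}

/-- The leading coefficient of a map `S_ν E → Sym E ⊗ S_μ E`. -/
noncomputable def lead (f : SchurModule K E ν →ₗ[K] PolyRing K E ⊗[K] SchurModule K E μ) :
    PolyRing K E := contractRight (hwCoord b μ) (f (hwVec b ν))

variable [CharZero K]

lemma schurRep_torus_hwVec (hν : Antitone ν) (t : Fin m → K) (ht : ∀ j, t j ≠ 0) :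
    schurRep K E ν (torusGL b t ht) (hwVec b ν) = (∏ j, t j ^ ν j) • hwVec b ν := by
  rw [torusGL, schurRep_hwVec b hν]
  · simp only [Matrix.diagonal_apply_eq, prod_box]
  · intro i j h
    exact Matrix.diagonal_apply_ne _ h.ne'

lemma hwCoord_torus (hν : Antitone ν) (t : Fin m → K) (ht : ∀ j, t j ≠ 0)
    (x : SchurModule K E ν) :
    hwCoord b ν (schurRep K E ν (torusGL b t ht) x) = (∏ j, t j ^ ν j) * hwCoord b ν x := by
  rw [torusGL, hwCoord_schurRep b hν]
  · simp only [Matrix.diagonal_apply_eq, prod_box]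
  · intro i j h
    exact Matrix.diagonal_apply_ne _ h.ne

/-- The highest weight vector is fixed by upper unipotent `X`, so its image `w` is too. Hence a zero
lead stays zero when `hwCoord` is replaced by its composite with `X`; since such composites detect
zero in `S_μ E`, every contraction of `w` vanishes. -/
lemma IsEquivariant.eq_zero (hf : IsEquivariant f) (hμ : Antitone μ) (hν : Antitone ν)
    (h0 : lead b f = 0) : f = 0 := by
  have hw : f (hwVec b ν) = 0 := by
    refine eq_zero_of_contractLeft fun θ => eq_zero_of_hwCoord b hμ _ fun X hX hup h1 => ?_
    have hv : schurRep K E ν (matGL b X hX) (hwVec b ν) = hwVec b ν := by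
      rw [schurRep_hwVec b hν X hX hup]
      simp [h1]
    have e := hf (matGL b X hX) (hwVec b ν)
    rw [hv] at e
    have e2 : lead b f = symMap K E (matGL b X hX)
        (contractRight (hwCoord b μ ∘ₗ schurRep K E μ (matGL b X hX)) (f (hwVec b ν))) := by
      conv_lhs => rw [lead, e, contractRight_map]
      rfl
    rw [h0] at e2
    have e3 := symMap_injective _ e2.symm
    have e4 := apply_contractRight θ (hwCoord b μ ∘ₗ schurRep K E μ (matGL b X hX)) (f (hwVec b ν))
    rw [e3, map_zero] at e4
    exact e4.symm
  refine eq_zero_of_hwVec b f fun g => ?_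
  rw [hf, hw, map_zero]

/-- Comparing torus weights, a monomial `x^n` with nonzero coefficient has `n + μ = ν`. No grading
is assumed on `f`: the weights determine the degree. -/
lemma IsEquivariant.toPoly_lead (hf : IsEquivariant f) (hμ : Antitone μ) (hν : Antitone ν)
    (κ : Fin m →₀ ℕ) (hκ : ∀ j, μ j + κ j = ν j) :
    toPoly b (lead b f) = MvPolynomial.monomial κ ((toPoly b (lead b f)).coeff κ) := by
  ext n
  rw [MvPolynomial.coeff_monomial]
  split_ifs with h
  · rw [h]
  by_contra hne
  refine h (Finsupp.ext fun j => ?_)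
  have ht := twoAt_ne_zero (K := K) j
  have e := hf (torusGL b (twoAt K j) ht) (hwVec b ν)
  rw [schurRep_torus_hwVec b hν, map_smul] at e
  have e2 := congrArg (contractRight (hwCoord b μ)) e
  rw [contractRight_map, map_smul] at e2
  have e3 : hwCoord b μ ∘ₗ schurRep K E μ (torusGL b (twoAt K j) ht) =
      (∏ i, twoAt K j i ^ μ i) • hwCoord b μ := by
    ext1 x
    exact hwCoord_torus b hμ _ ht x
  have e4 : contractRight ((∏ i, twoAt K j i ^ μ i) • hwCoord b μ) (f (hwVec b ν)) =
      (∏ i, twoAt K j i ^ μ i) • lead b f := by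
    simp [lead, contractRight, LinearMap.lTensor_smul]
  rw [e3, e4, map_smul] at e2
  have e5 := congrArg (fun q => (toPoly b q).coeff n) e2
  simp only [map_smul, MvPolynomial.coeff_smul, AlgHom.toLinearMap_apply, smul_eq_mul,
    toPoly_symMap_torus, coeff_aeval_smul_X, prod_twoAt_pow] at e5
  change _ * (toPoly b (lead b f)).coeff n = _ at e5
  rw [← mul_assoc, ← pow_add] at e5
  have e6 := two_pow_inj (mul_right_cancel₀ hne e5)
  have := hκ j
  omega

/-- Multiplicity one in Pieri's formula. -/
lemma IsEquivariant.exists_smul {f' : SchurModule K E ν →ₗ[K] PolyRing K E ⊗[K] SchurModule K E μ}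
    (b : Module.Basis (Fin m) K E) (hf : IsEquivariant f) (hf' : IsEquivariant f') (hμ : Antitone μ) (hν : Antitone ν)
    (h : ∀ j, μ j ≤ ν j) (h0 : f' ≠ 0) : ∃ s : K, f = s • f' := by
  let κ : Fin m →₀ ℕ := Finsupp.equivFunOnFinite.symm fun j => ν j - μ j
  have hκ : ∀ j, μ j + κ j = ν j := fun j => by
    have := h j
    simp only [κ, Finsupp.equivFunOnFinite_symm_apply_apply]
    omega
  have e := hf.toPoly_lead b hμ hν κ hκ
  have e' := hf'.toPoly_lead b hμ hν κ hκ
  set s := (toPoly b (lead b f)).coeff κ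
  set s' := (toPoly b (lead b f')).coeff κ
  have hs' : s' ≠ 0 := by
    intro hs
    rw [hs, MvPolynomial.monomial_zero] at e'
    exact h0 (hf'.eq_zero b hμ hν (eq_zero_of_toPoly b e'))
  -- This ratio makes the leading coefficients cancel.
  refine ⟨s / s', sub_eq_zero.1 ?_⟩
  have hd : IsEquivariant (f - (s / s') • f') := by
    intro g x
    simp only [LinearMap.sub_apply, LinearMap.smul_apply, map_sub, map_smul, hf g x, hf' g x]
  refine hd.eq_zero b hμ hν (eq_zero_of_toPoly b ?_)
  have : lead b (f - (s / s') • f') = lead b f - (s / s') • lead b f' := by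
    simp [lead]
  rw [this, map_sub, map_smul, e, e', MvPolynomial.smul_monomial, smul_eq_mul,
    div_mul_cancel₀ _ hs', sub_self]

/-- The algebra map `Sym E → K` taking a basis vector to `1` and the others to `0`. -/
noncomputable def evalAt (k : Fin m) : PolyRing K E →ₐ[K] K := SymmetricAlgebra.lift (b.coord k)

/-- If `ν` is obtained from `μ` by adding boxes in two rows such that two of the new boxes lie in
one column, there are no equivariant maps. -/
lemma IsEquivariant.eq_zero_of_column (b : Module.Basis (Fin m) K E) (hf : IsEquivariant f) (hμ : Antitone μ) (hν : Antitone ν)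
    {k k' : Fin m} (hk : k < k') (h1 : ∀ j, j ≠ k → j ≠ k' → ν j = μ j) (h2 : μ k ≤ ν k)
    (h3 : ν k' = μ k + 1) : f = 0 := by
  classical
  have hle : ∀ j, μ j ≤ ν j := by
    intro j
    rcases eq_or_ne j k with rfl | hj
    · exact h2
    rcases eq_or_ne j k' with rfl | hj'
    · exact (hμ hk.le).trans (by omega)
    · exact (h1 j hj hj').ge
  let κ : Fin m →₀ ℕ := Finsupp.equivFunOnFinite.symm fun j => ν j - μ j
  have hκ : ∀ j, μ j + κ j = ν j := fun j => by
    have := hle j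
    simp only [κ, Finsupp.equivFunOnFinite_symm_apply_apply]
    omega
  have e := hf.toPoly_lead b hμ hν κ hκ
  set s := (toPoly b (lead b f)).coeff κ
  refine hf.eq_zero b hμ hν (eq_zero_of_toPoly b ?_)
  rw [e]
  suffices hs : s = 0 by rw [hs, MvPolynomial.monomial_zero]
  set w := f (hwVec b ν) with hw
  -- Evaluating `Sym E` at `x_k = 1`, other `x_j = 0`, is insensitive to the torus coordinates `j ≠
  -- k`. So a filling in the support of the contraction contains each `j ≠ k` exactly `ν j` times.
  have hy : contractLeft (evalAt b k).toLinearMap w = 0 := by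
    refine Subtype.ext (tcoord_ext b fun S => ?_)
    rw [Submodule.coe_zero, tcoord_zero, Pi.zero_apply]
    by_contra hne
    have hS : ColInj S := by
      by_contra hS
      exact hne (schur_tcoord_eq_zero b _ hS)
    have hcont : ∀ j, j ≠ k → (Finset.univ.filter fun c => S c = j).card = ν j := by
      intro j hj
      have ht := twoAt_ne_zero (K := K) j
      have e := hf (torusGL b (twoAt K j) ht) (hwVec b ν)
      rw [schurRep_torus_hwVec b hν, map_smul] at e
      have e2 := congrArg (contractLeft (evalAt b k).toLinearMap) e
      have e3 : (evalAt b k).toLinearMap ∘ₗ (symMap K E (torusGL b (twoAt K j) ht)).toLinearMap =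
          (evalAt b k).toLinearMap := by
        have : (evalAt b k).comp (symMap K E (torusGL b (twoAt K j) ht)) = evalAt b k := by
          refine SymmetricAlgebra.algHom_ext (b.ext fun i => ?_)
          change evalAt b k (symMap K E _ (SymmetricAlgebra.ι K E (b i))) =
            evalAt b k (SymmetricAlgebra.ι K E (b i))
          rw [symMap_ι, torusGL_apply, map_smul, map_smul]
          rcases eq_or_ne i j with rfl | hi
          · simp [evalAt, hj]
          · simp [twoAt, Function.update_of_ne hi]
        conv_rhs => rw [← this]
        rfl
      rw [contractLeft_map, map_smul, e3, ← hw] at e2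
      have e4 := congrArg (fun x : SchurModule K E μ => tcoord b (x : BoxTensor K E μ) S) e2
      simp only [schurRep_coe, tcoord_torus, Submodule.coe_smul, tcoord_smul, Pi.smul_apply,
        smul_eq_mul, prod_twoAt_pow] at e4
      have e5 := mul_right_cancel₀ hne e4
      have e6 : ∏ c, twoAt K j (S c) = 2 ^ (Finset.univ.filter fun c => S c = j).card := by
        simp only [twoAt, Function.update_apply, Pi.one_apply]
        rw [Finset.prod_ite]
        simp
      rw [e6] at e5
      exact (two_pow_inj e5).symm
    -- These `k + 1` values occur `∑_{j<k} μ j + ν k'` times in total, one more than the number of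
    -- boxes in rows `≤ k`; column injectivity forbids this.
    have hJ : (insert k' (Finset.Iio k)).card = (k : ℕ) + 1 := by
      rw [Finset.card_insert_of_notMem (by simpa using hk.le)]
      simp
    have hcard := hS.card_le hμ k (insert k' (Finset.Iio k)) hJ.le
    have c1 : (Finset.univ.filter fun c => S c ∈ insert k' (Finset.Iio k)).card =
        ∑ j ∈ insert k' (Finset.Iio k), ν j := by
      rw [Finset.card_eq_sum_card_fiberwise (f := S) (t := insert k' (Finset.Iio k))
        (fun c hc => by simpa using hc)]
      refine Finset.sum_congr rfl fun j hj => ?_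
      rw [← hcont j (by
        rintro rfl
        simp [hk.ne] at hj), Finset.filter_filter]
      congr 1
      ext c
      simp only [Finset.mem_filter, Finset.mem_univ, true_and]
      exact ⟨fun h => h.2, fun h => ⟨h ▸ hj, h⟩⟩
    have c2 : (Finset.univ.filter fun c : Box μ => c.1 ≤ k).card = ∑ j ∈ Finset.Iic k, μ j := by
      have : (Finset.univ.filter fun c : Box μ => c.1 ≤ k) =
          (Finset.Iic k).sigma fun _ => Finset.univ := by
        ext c; simp
      rw [this, Finset.card_sigma]
      simp
    rw [c1, c2, Finset.sum_insert (by simpa using hk.le), h3, ← Finset.Iio_insert,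
      Finset.sum_insert (by simp)] at hcard
    have : ∑ j ∈ Finset.Iio k, ν j = ∑ j ∈ Finset.Iio k, μ j :=
      Finset.sum_congr rfl fun j hj => h1 j (Finset.mem_Iio.1 hj).ne
        ((Finset.mem_Iio.1 hj).trans hk).ne
    omega
  -- The transvection fixes `w`, so the contraction also vanishes for the evaluation at `x_k =
  -- x_{k'} = 1`, other `x_j = 0`. On the lead, whose exponent is supported on `k` and `k'`, that
  -- evaluation returns the coefficient `s`.
  have hX : (Matrix.transvection k k' (1 : K)).det ≠ 0 := by
    rw [Matrix.det_transvection_of_ne _ _ hk.ne]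
    exact one_ne_zero
  have hXe : ∀ i j, Matrix.transvection k k' (1 : K) i j =
      (if i = j then 1 else 0) + if k = i ∧ k' = j then 1 else 0 := by
    intro i j
    simp [Matrix.transvection, Matrix.one_apply, Matrix.single_apply]
  set g : GLin K E := matGL b (Matrix.transvection k k' 1) hX with hg
  have hgv : schurRep K E ν g (hwVec b ν) = hwVec b ν := by
    rw [hg, schurRep_hwVec b hν]
    · rw [Finset.prod_eq_one, one_smul]
      intro c _
      rw [hXe, if_pos rfl, if_neg, add_zero]
      rintro ⟨rfl, h⟩
      exact hk.ne h.symm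
    · intro i j hij
      rw [hXe, if_neg hij.ne', if_neg, add_zero]
      rintro ⟨rfl, rfl⟩
      exact absurd hij hk.asymm
  have hgw : TensorProduct.map (symMap K E g).toLinearMap (schurRep K E μ g) w = w := by
    rw [hw, ← hf, hgv]
  have r1 : contractLeft ((evalAt b k).toLinearMap ∘ₗ (symMap K E g).toLinearMap) w = 0 := by
    have := contractLeft_map (evalAt b k).toLinearMap (symMap K E g).toLinearMap
      (schurRep K E μ g) w
    rw [hgw, hy] at this
    have h2 := congrArg (schurRep K E μ g⁻¹) this
    rw [map_zero, Representation.inv_self_apply] at h2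
    exact h2.symm
  have r2 : (evalAt b k) (symMap K E g (lead b f)) = 0 := by
    have := apply_contractRight ((evalAt b k).toLinearMap ∘ₗ (symMap K E g).toLinearMap)
      (hwCoord b μ) w
    rw [r1, map_zero] at this
    exact this
  have r3 : ∀ a, (evalAt b k) (symMap K E g a) =
      MvPolynomial.aeval (fun j => if j = k ∨ j = k' then (1 : K) else 0) (toPoly b a) := by
    intro a
    have : (evalAt b k).comp (symMap K E g) =
        (MvPolynomial.aeval (fun j => if j = k ∨ j = k' then (1 : K) else 0)).comp
          (toPoly b).toAlgHom := by
      refine SymmetricAlgebra.algHom_ext (b.ext fun j => ?_)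
      have : b.repr ((g : E →ₗ[K] E) (b j)) k = _ := repr_matGL b _ hX k j
      rw [hXe] at this
      change SymmetricAlgebra.lift (b.coord k) (symMap K E g (SymmetricAlgebra.ι K E (b j))) =
        MvPolynomial.aeval _ (toPoly b (SymmetricAlgebra.ι K E (b j)))
      rw [symMap_ι, toPoly_ι, MvPolynomial.aeval_X, SymmetricAlgebra.lift_ι_apply,
        Module.Basis.coord_apply, this]
      rcases eq_or_ne j k with rfl | hj
      · simp [hk.ne']
      · simp [hj, hj.symm, eq_comm]
    exact DFunLike.congr_fun this a
  rw [r3, e, MvPolynomial.aeval_monomial, Finsupp.prod_fintype _ _ (fun _ => pow_zero _)] at r2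
  rw [Finset.prod_eq_one, mul_one] at r2
  · exact r2
  · intro j _
    by_cases hj : j = k ∨ j = k'
    · simp [hj]
    · have : κ j = 0 := by
        push Not at hj
        have := h1 j hj.1 hj.2
        have := hκ j
        omega
      rw [this, pow_zero]

end EquivariantMaps

/-! ### Construction of the Pieri maps. -/

section Pieri

variable {m : ℕ} {μ ν : Fin m → ℕ}

/-- The boxes of `ν` outside `μ`. -/
abbrev SkewBox (μ ν : Fin m → ℕ) : Type := {c : Box ν // μ c.1 ≤ c.2}

/-- The boxes of `ν` are those of `μ` together with the others. -/
noncomputable def boxEquiv (h : ∀ j, μ j ≤ ν j) : Box μ ⊕ SkewBox μ ν ≃ Box ν :=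
  Equiv.ofBijective (Sum.elim (fun c => ⟨c.1, Fin.castLE (h c.1) c.2⟩) Subtype.val) (by
    constructor
    · rintro (c | c) (c' | c') hc
      · have h1 := congrArg Sigma.fst hc
        have h2 := congrArg (fun d : Box ν => (d.2 : ℕ)) hc
        exact congrArg Sum.inl (box_ext h1 h2)
      · have := c'.2
        rw [Sum.elim_inr] at hc
        rw [← hc] at this
        exact absurd c.2.2 (not_lt.2 this)
      · have := c.2
        rw [Sum.elim_inr] at hc
        rw [hc] at this
        exact absurd c'.2.2 (not_lt.2 this)
      · congr 1
        exact Subtype.ext hc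
    · intro c
      by_cases hc : (c.2 : ℕ) < μ c.1
      · exact ⟨Sum.inl ⟨c.1, ⟨c.2, hc⟩⟩, rfl⟩
      · exact ⟨Sum.inr ⟨c, not_lt.1 hc⟩, rfl⟩)

lemma boxEquiv_inr (h : ∀ j, μ j ≤ ν j) (c : SkewBox μ ν) : boxEquiv h (Sum.inr c) = c := rfl

lemma card_skewBox (h : ∀ j, μ j ≤ ν j) {k : Fin m} (hk : ∀ j, j ≠ k → ν j = μ j) :
    Fintype.card (SkewBox μ ν) = ν k - μ k := by
  have h1 := Fintype.card_congr (boxEquiv h)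
  rw [Fintype.card_sum, Fintype.card_sigma, Fintype.card_sigma] at h1
  simp only [Fintype.card_fin] at h1
  have h2 : ∑ j ∈ Finset.univ.erase k, ν j = ∑ j ∈ Finset.univ.erase k, μ j :=
    Finset.sum_congr rfl fun j hj => hk j (Finset.ne_of_mem_erase hj)
  have h3 := Finset.add_sum_erase _ μ (Finset.mem_univ k)
  have h4 := Finset.add_sum_erase _ ν (Finset.mem_univ k)
  omega

/-- Extend a permutation of the boxes of `μ` to those of `ν`. -/
noncomputable def extendPerm (h : ∀ j, μ j ≤ ν j) (τ : Equiv.Perm (Box μ)) :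
    Equiv.Perm (Box ν) := (boxEquiv h).permCongr (Equiv.sumCongr τ 1)

lemma extendPerm_apply (h : ∀ j, μ j ≤ ν j) (τ : Equiv.Perm (Box μ)) (c : Box μ ⊕ SkewBox μ ν) :
    extendPerm h τ (boxEquiv h c) = boxEquiv h (Equiv.sumCongr τ 1 c) := by
  simp [extendPerm]

lemma sign_extendPerm (h : ∀ j, μ j ≤ ν j) (τ : Equiv.Perm (Box μ)) :
    Equiv.Perm.sign (extendPerm h τ) = Equiv.Perm.sign τ := by
  rw [extendPerm, Equiv.Perm.sign_permCongr]
  exact (Equiv.Perm.sign_sumCongr τ 1).trans (by simp)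

lemma extendPerm_mem (h : ∀ j, μ j ≤ ν j) {τ : Equiv.Perm (Box μ)} (hτ : τ ∈ colPerms μ) :
    extendPerm h τ ∈ colPerms ν := by
  have hτ' : ∀ c, ((τ c).2 : ℕ) = c.2 := by simpa [colPerms] using hτ
  simp only [colPerms, Finset.mem_filter, Finset.mem_univ, true_and]
  intro c
  obtain ⟨c, rfl⟩ := (boxEquiv h).surjective c
  rw [extendPerm_apply]
  rcases c with c | c
  · exact hτ' c
  · rfl

/-- Extend a filling of `μ` to `ν` by the constant `k`. -/
noncomputable def extendFill (h : ∀ j, μ j ≤ ν j) (k : Fin m) (S : Box μ → Fin m) :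
    Box ν → Fin m := Sum.elim S (fun _ => k) ∘ (boxEquiv h).symm

lemma extendFill_comp (h : ∀ j, μ j ≤ ν j) (k : Fin m) (S : Box μ → Fin m)
    (τ : Equiv.Perm (Box μ)) : extendFill h k (S ∘ τ) = extendFill h k S ∘ extendPerm h τ := by
  funext c
  obtain ⟨c, rfl⟩ := (boxEquiv h).surjective c
  simp only [extendFill, Function.comp_apply, extendPerm_apply, Equiv.symm_apply_apply]
  rcases c with c | c <;> rfl

lemma extendFill_rowFill (h : ∀ j, μ j ≤ ν j) {k : Fin m} (hk : ∀ j, j ≠ k → ν j = μ j) :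
    extendFill h k (rowFill μ) = rowFill ν := by
  funext c
  obtain ⟨c, rfl⟩ := (boxEquiv h).surjective c
  simp only [extendFill, Function.comp_apply, Equiv.symm_apply_apply]
  rcases c with c | c
  · rfl
  · rw [boxEquiv_inr]
    by_contra hne
    have h1 := hk c.1.1 (fun h => hne h.symm)
    have h2 := c.2
    have h3 := c.1.2.2
    omega

variable (K : Type*) [Field K] (E : Type*) [AddCommGroup E] [Module K E]

/-- Split off the boxes of `ν` outside `μ` and multiply the corresponding factors in `Sym E`. -/
noncomputable def splitMap (h : ∀ j, μ j ≤ ν j) :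
    BoxTensor K E ν →ₗ[K] PolyRing K E ⊗[K] BoxTensor K E μ :=
  (TensorProduct.comm K _ _).toLinearMap ∘ₗ
    LinearMap.lTensor (BoxTensor K E μ)
      (PiTensorProduct.lift ((MultilinearMap.mkPiAlgebra K (SkewBox μ ν) (PolyRing K E)).compLinearMap
        fun _ => SymmetricAlgebra.ι K E)) ∘ₗ
    (PiTensorProduct.tmulEquiv K E).symm.toLinearMap ∘ₗ
    (PiTensorProduct.reindex K (fun _ : Box ν => E) (boxEquiv h).symm).toLinearMap

variable {K E}

lemma splitMap_tprod (h : ∀ j, μ j ≤ ν j) (v : Box ν → E) :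
    splitMap K E h (PiTensorProduct.tprod K v) =
      (∏ c : SkewBox μ ν, SymmetricAlgebra.ι K E (v c)) ⊗ₜ
        PiTensorProduct.tprod K fun c => v (boxEquiv h (Sum.inl c)) := by
  simp only [splitMap, LinearMap.comp_apply, LinearEquiv.coe_coe, PiTensorProduct.reindex_tprod,
    PiTensorProduct.tmulEquiv_symm_apply, LinearMap.lTensor_tmul, PiTensorProduct.lift.tprod,
    TensorProduct.comm_tmul, MultilinearMap.compLinearMap_apply, MultilinearMap.mkPiAlgebra_apply]
  rfl

lemma splitMap_tensorRep (h : ∀ j, μ j ≤ ν j) (g : GLin K E) (x : BoxTensor K E ν) :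
    splitMap K E h (tensorRep K E ν g x) =
      TensorProduct.map (symMap K E g).toLinearMap (tensorRep K E μ g) (splitMap K E h x) := by
  induction x using PiTensorProduct.induction_on with
  | smul_tprod r v =>
    have h1 : ∀ {κ : Fin m → ℕ} (v : Box κ → E), tensorRep K E κ g (PiTensorProduct.tprod K v) =
        PiTensorProduct.tprod K fun c => (g : E →ₗ[K] E) (v c) :=
      fun v => PiTensorProduct.map_tprod _ _
    rw [map_smul, map_smul, map_smul, map_smul, h1, splitMap_tprod, splitMap_tprod,
      TensorProduct.map_tmul, h1, AlgHom.toLinearMap_apply, map_prod]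
    simp only [symMap_ι]
  | add x y hx hy => simp only [map_add, hx, hy]

lemma prod_ι_mem {X : Type*} (s : Finset X) (v : X → E) :
    ∏ c ∈ s, SymmetricAlgebra.ι K E (v c) ∈ LinearMap.range (SymmetricAlgebra.ι K E) ^ s.card := by
  classical
  induction s using Finset.induction_on with
  | empty => simp
  | insert a s ha ih =>
    rw [Finset.prod_insert ha, Finset.card_insert_of_notMem ha, pow_succ']
    exact Submodule.mul_mem_mul ⟨_, rfl⟩ ih

/-- An equivariant map `S_ν E → Sym E ⊗ S_μ E`. -/
noncomputable def pieriMap (K : Type*) [Field K] (E : Type*) [AddCommGroup E] [Module K E]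
    (h : ∀ j, μ j ≤ ν j) :
    SchurModule K E ν →ₗ[K] PolyRing K E ⊗[K] SchurModule K E μ :=
  LinearMap.lTensor (PolyRing K E) (youngSymmetrizer K E μ).rangeRestrict ∘ₗ splitMap K E h ∘ₗ
    (LinearMap.range (youngSymmetrizer K E ν)).subtype

lemma pieriMap_isEquivariant (h : ∀ j, μ j ≤ ν j) : IsEquivariant (pieriMap K E h) := by
  intro g x
  have h1 : ∀ w : PolyRing K E ⊗[K] BoxTensor K E μ,
      LinearMap.lTensor (PolyRing K E) (youngSymmetrizer K E μ).rangeRestrict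
        (TensorProduct.map (symMap K E g).toLinearMap (tensorRep K E μ g) w) =
      TensorProduct.map (symMap K E g).toLinearMap (schurRep K E μ g)
        (LinearMap.lTensor (PolyRing K E) (youngSymmetrizer K E μ).rangeRestrict w) := by
    intro w
    induction w using TensorProduct.induction_on with
    | zero => simp
    | tmul a y =>
      rw [TensorProduct.map_tmul, LinearMap.lTensor_tmul, LinearMap.lTensor_tmul,
        TensorProduct.map_tmul]
      congr 1
      exact Subtype.ext (tensorRep_youngSymmetrizer K E μ g y).symm
    | add x y hx hy => simp only [map_add, hx, hy]
  simp only [pieriMap, LinearMap.comp_apply, Submodule.subtype_apply, schurRep_coe,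
    splitMap_tensorRep, h1]

lemma pieriMap_mem (h : ∀ j, μ j ≤ ν j) (x : SchurModule K E ν) :
    pieriMap K E h x ∈ LinearMap.range (TensorProduct.map
      (symDeg K E (Fintype.card (SkewBox μ ν))).subtype
      (LinearMap.id : SchurModule K E μ →ₗ[K] SchurModule K E μ)) := by
  obtain ⟨x, hx⟩ := x
  simp only [pieriMap, LinearMap.comp_apply, Submodule.subtype_apply]
  clear hx
  induction x using PiTensorProduct.induction_on with
  | smul_tprod r v =>
    rw [map_smul, map_smul, splitMap_tprod, LinearMap.lTensor_tmul]
    refine Submodule.smul_mem _ _ ⟨⟨_, ?_⟩ ⊗ₜ _, TensorProduct.map_tmul _ _ _ _⟩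
    rw [symDeg, if_pos (Int.natCast_nonneg _), Int.toNat_natCast]
    exact prod_ι_mem Finset.univ fun c : SkewBox μ ν => v c
  | add x y hx hy =>
    rw [map_add, map_add]
    exact Submodule.add_mem _ hx hy

variable (b : Module.Basis (Fin m) K E)

/-- Evaluation at `x_k = 1`, other `x_j = 0`, selects the fillings with `k` in every new box. -/
lemma tcoord_contract_splitMap (h : ∀ j, μ j ≤ ν j) (k : Fin m) (x : BoxTensor K E ν)
    (S : Box μ → Fin m) :
    tcoord b (contractLeft (evalAt b k).toLinearMap (splitMap K E h x)) S =
      tcoord b x (extendFill h k S) := by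
  induction x using PiTensorProduct.induction_on with
  | smul_tprod r v =>
    have e : (evalAt b k).toLinearMap (∏ c : SkewBox μ ν, SymmetricAlgebra.ι K E (v c)) =
        ∏ c : SkewBox μ ν, b.repr (v c) k := by
      rw [AlgHom.toLinearMap_apply, map_prod]
      exact Finset.prod_congr rfl fun c _ => SymmetricAlgebra.lift_ι_apply _ _
    rw [map_smul, map_smul, tcoord_smul, tcoord_smul, Pi.smul_apply, Pi.smul_apply, splitMap_tprod,
      contractLeft_tmul, e, tcoord_smul, Pi.smul_apply, tcoord_tprod, tcoord_tprod,
      ← (boxEquiv h).prod_comp, Fintype.prod_sum_type, smul_eq_mul, smul_eq_mul, mul_comm (∏ c, _)]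
    simp only [extendFill, Function.comp_apply, Equiv.symm_apply_apply, Sum.elim_inl, Sum.elim_inr]
    rfl
  | add x y hx hy => rw [map_add, map_add, tcoord_add, tcoord_add, Pi.add_apply, Pi.add_apply, hx, hy]

lemma rowSym_tBasis (S : Box ν → Fin m) (hS : ∀ ρ ∈ rowPerms ν, S ∘ ρ = S) :
    rowSym K E ν (tBasis b ν S) = ((rowPerms ν).card : K) • tBasis b ν S := by
  classical
  refine rowSym_of_comp b _ fun τ hτ R => ?_
  rw [tcoord_tBasis, tcoord_tBasis]
  congr 1
  simp only [eq_iff_iff]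
  constructor
  · intro h
    funext c
    have h1 := congr_fun h (τ.symm c)
    have h2 := congr_fun (hS τ hτ) (τ.symm c)
    simp only [Function.comp_apply, Equiv.apply_symm_apply] at h1 h2
    rw [h2, h1]
  · rintro rfl
    exact (hS τ hτ).symm

lemma rowFill_comp {ρ : Equiv.Perm (Box ν)} (hρ : ρ ∈ rowPerms ν) : rowFill ν ∘ ρ = rowFill ν := by
  have hρ' : ∀ c, (ρ c).1 = c.1 := by simpa [rowPerms] using hρ
  exact funext hρ'

lemma card_rowPerms_ne_zero [CharZero K] : ((rowPerms ν).card : K) ≠ 0 :=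
  Nat.cast_ne_zero.2 (rowPerms_isSigned ν).card_pos.ne'

lemma card_colPerms_ne_zero [CharZero K] : ((colPerms ν).card : K) ≠ 0 :=
  Nat.cast_ne_zero.2 (colPerms_isSigned ν).card_pos.ne'

lemma tcoord_colAlt_rowFill :
    tcoord b (colAlt K E ν (tBasis b ν (rowFill ν))) (rowFill ν) = 1 := by
  classical
  rw [tcoord_colAlt, permSum, Finset.sum_eq_single 1]
  · rw [tcoord_tBasis, if_pos (show rowFill ν = rowFill ν ∘ (1 : Equiv.Perm (Box ν)) from rfl)]
    simp
  · intro σ hσ hne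
    rw [tcoord_tBasis, if_neg, smul_zero]
    intro h
    refine hne (Equiv.ext fun c => ?_)
    have hσ' : ∀ c, ((σ c).2 : ℕ) = c.2 := by simpa [colPerms] using hσ
    exact box_ext (congr_fun h c).symm (hσ' c)
  · exact fun h => absurd (colPerms_isSigned ν).one_mem h

lemma hwVec_coe : (hwVec b ν : BoxTensor K E ν) =
    ((rowPerms ν).card : K) • colAlt K E ν (tBasis b ν (rowFill ν)) := by
  rw [hwVec]
  simp only
  rw [youngSymmetrizer_apply, rowSym_tBasis b _ fun _ => rowFill_comp, map_smul]

variable [CharZero K]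

/-- Let `y` be the contraction of the split highest weight vector at `x_k = 1`, other `x_j = 0`. It
is alternating along columns, so if the Pieri map were zero, `c r y = 0` would give `r y = 0`. But
the coordinate of `r y` at `rowFill μ` is the product of the orders of the two row groups. -/
lemma pieriMap_ne_zero (b : Module.Basis (Fin m) K E) (h : ∀ j, μ j ≤ ν j) {k : Fin m}
    (hk : ∀ j, j ≠ k → ν j = μ j) : pieriMap K E h ≠ 0 := by
  intro h0
  set y : BoxTensor K E μ :=
    contractLeft (evalAt b k).toLinearMap (splitMap K E h (hwVec b ν : BoxTensor K E ν)) with hy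
  have hyc : ∀ S, tcoord b y S =
      tcoord b (hwVec b ν : BoxTensor K E ν) (extendFill h k S) :=
    tcoord_contract_splitMap b h k _
  have h1 : youngSymmetrizer K E μ y = 0 := by
    have h2 : ∀ w : PolyRing K E ⊗[K] BoxTensor K E μ,
        (contractLeft (evalAt b k).toLinearMap
          (LinearMap.lTensor (PolyRing K E) (youngSymmetrizer K E μ).rangeRestrict w) :
            SchurModule K E μ) =
        (youngSymmetrizer K E μ).rangeRestrict (contractLeft (evalAt b k).toLinearMap w) := by
      intro w
      induction w using TensorProduct.induction_on with
      | zero => simp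
      | tmul a x => simp
      | add x y hx hy => simp only [map_add, hx, hy]
    have h3 := h2 (splitMap K E h (hwVec b ν : BoxTensor K E ν))
    have h4 : LinearMap.lTensor (PolyRing K E) (youngSymmetrizer K E μ).rangeRestrict
        (splitMap K E h (hwVec b ν : BoxTensor K E ν)) = pieriMap K E h (hwVec b ν) := rfl
    rw [h4, h0, LinearMap.zero_apply, map_zero] at h3
    exact (congrArg Subtype.val h3).symm
  have h2 : colAlt K E μ y = ((colPerms μ).card : K) • y := by
    refine colAlt_of_comp b y fun τ hτ S => ?_
    rw [hyc, hyc, hwVec_coe, ← map_smul, extendFill_comp, colAlt_comp b _ (extendPerm_mem h hτ),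
      sign_extendPerm]
  have h3 : rowSym K E μ y = 0 := by
    have := rowSym_colAlt_eq_zero b (x := y) (by rw [h2, map_smul, h1, smul_zero])
    rw [h2, map_smul] at this
    exact (smul_eq_zero.1 this).resolve_left card_colPerms_ne_zero
  have h4 : tcoord b (rowSym K E μ y) (rowFill μ) = 0 := by rw [h3, tcoord_zero, Pi.zero_apply]
  rw [tcoord_rowSym, permSum, Finset.sum_congr rfl fun ρ hρ => by rw [rowFill_comp hρ], hyc,
    extendFill_rowFill h hk, hwVec_coe, tcoord_smul, Pi.smul_apply, tcoord_colAlt_rowFill] at h4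
  simp only [one_smul, Finset.sum_const, smul_eq_mul, mul_one, nsmul_eq_mul] at h4
  rcases mul_eq_zero.1 h4 with h5 | h5
  · exact card_rowPerms_ne_zero h5
  · exact card_rowPerms_ne_zero h5

end Pieri

/-! ### The product of column determinants of a rectangle of vectors. -/

section RectangleForm

variable {K : Type*} [Field K] {E : Type*} [AddCommGroup E] [Module K E] {m : ℕ}
  (b : Module.Basis (Fin m) K E) (N : ℕ)

/-- Changing one vector affects only the determinant of its own column, which makes the product
multilinear. -/
lemma det_update (w : Fin N × Fin m → E) (r : Fin N × Fin m) (v : E)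
    [DecidableEq (Fin N × Fin m)] :
    (fun l => b.det fun j => Function.update w r v (l, j)) =
      Function.update (fun l => b.det fun j => w (l, j)) r.1
        (b.det (Function.update (fun j => w (r.1, j)) r.2 v)) := by
  obtain ⟨l0, j0⟩ := r
  funext l
  rcases eq_or_ne l l0 with rfl | hl
  · rw [Function.update_self]
    congr 1
    funext j
    rcases eq_or_ne j j0 with rfl | hj
    · simp
    · rw [Function.update_of_ne hj, Function.update_of_ne]
      exact fun h => hj (congrArg Prod.snd h)
  · rw [Function.update_of_ne hl]
    congr 1
    funext j
    rw [Function.update_of_ne]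
    exact fun h => hl (congrArg Prod.fst h)

/-- The product of the determinants of the columns of a rectangle of vectors. -/
noncomputable def rectForm : MultilinearMap K (fun _ : Fin N × Fin m => E) K where
  toFun w := ∏ l, b.det fun j => w (l, j)
  map_update_add' w r x y := by
    simp only [det_update]
    rw [AlternatingMap.map_update_add]
    exact (MultilinearMap.mkPiAlgebra K (Fin N) K).map_update_add _ _ _ _
  map_update_smul' w r c x := by
    simp only [det_update]
    rw [AlternatingMap.map_update_smul]
    exact (MultilinearMap.mkPiAlgebra K (Fin N) K).map_update_smul _ _ _ _

lemma rectForm_apply (w : Fin N × Fin m → E) : rectForm b N w = ∏ l, b.det fun j => w (l, j) := rfl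

lemma rectForm_map (g : E →ₗ[K] E) (w : Fin N × Fin m → E) :
    rectForm b N (fun p => g (w p)) = LinearMap.det g ^ N * rectForm b N w := by
  have h : ∀ l, (b.det fun j => g (w (l, j))) = LinearMap.det g * b.det fun j => w (l, j) :=
    fun l => b.det_comp g _
  rw [rectForm_apply, rectForm_apply, Finset.prod_congr rfl fun l _ => h l,
    Finset.prod_mul_distrib]
  simp

lemma rectForm_perm (τ : Equiv.Perm (Fin N × Fin m)) (hτ : ∀ p, (τ p).1 = p.1)
    (w : Fin N × Fin m → E) :
    rectForm b N (w ∘ τ) = ((Equiv.Perm.sign τ : ℤ) : K) * rectForm b N w := by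
  have hb : ∀ l, Function.Bijective fun j => (τ (l, j)).2 := fun l => by
    refine Finite.injective_iff_bijective.1 fun j j' h => ?_
    have : τ (l, j) = τ (l, j') := Prod.ext ((hτ (l, j)).trans (hτ (l, j')).symm) h
    exact congrArg Prod.snd (τ.injective this)
  let σ : Fin N → Equiv.Perm (Fin m) := fun l => Equiv.ofBijective _ (hb l)
  have hσ : τ = Equiv.prodCongrRight σ := by
    refine Equiv.ext fun ⟨l, j⟩ => Prod.ext (hτ _) rfl
  have h : ∀ l, (b.det fun j => (w ∘ τ) (l, j)) =
      ((Equiv.Perm.sign (σ l) : ℤ) : K) * b.det fun j => w (l, j) := by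
    intro l
    have e : (fun j => (w ∘ τ) (l, j)) = (fun j => w (l, j)) ∘ σ l := by
      rw [hσ]
      rfl
    rw [e, AlternatingMap.map_perm, Units.smul_def, zsmul_eq_mul]
  rw [rectForm_apply, rectForm_apply, Finset.prod_congr rfl fun l _ => h l,
    Finset.prod_mul_distrib, hσ, Equiv.Perm.sign_prodCongrRight]
  simp

lemma rectForm_basis (φ : Fin N × Fin m → Fin m) (h : rectForm b N (fun p => b (φ p)) ≠ 0)
    (l : Fin N) : Function.Injective fun j => φ (l, j) := by
  intro j j' hj
  by_contra hne
  refine h (Finset.prod_eq_zero (Finset.mem_univ l) ?_)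
  exact b.det.map_eq_zero_of_eq _ (congrArg b hj) hne

end RectangleForm

/-! ### The perfect pairing of Schur modules of complementary partitions. -/

section Complement

variable {m N : ℕ} {μ μ' : Fin m → ℕ}

/-- The boxes of `μ`, together with those of the rotated partition `μ'`, fill a rectangle. -/
noncomputable def rectEquiv (h : ∀ j, μ j + μ' j.rev = N) : Box μ ⊕ Box μ' ≃ Fin N × Fin m :=
  Equiv.ofBijective (Sum.elim
    (fun c => (⟨c.2, by have := h c.1; have := c.2.2; omega⟩, c.1))
    (fun c => (Fin.rev ⟨c.2, by
      have := h c.1.rev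
      rw [Fin.rev_rev] at this
      have := c.2.2
      omega⟩, c.1.rev))) (by
    constructor
    · rintro (c | c) (c' | c') hc <;> simp only [Sum.elim_inl, Sum.elim_inr, Prod.mk.injEq] at hc
      · exact congrArg Sum.inl (box_ext hc.2 (congrArg Fin.val hc.1))
      · have h1 := congrArg Fin.val hc.1
        have h2 := h c.1
        have h3 := c.2.2
        have h4 := c'.2.2
        rw [hc.2, Fin.rev_rev] at h2
        have h5 : μ c.1 = μ c'.1.rev := congrArg μ hc.2
        simp only [Fin.val_rev] at h1
        omega
      · have h1 := congrArg Fin.val hc.1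
        have h2 := h c'.1
        have h3 := c.2.2
        have h4 := c'.2.2
        rw [← hc.2, Fin.rev_rev] at h2
        have h5 : μ c'.1 = μ c.1.rev := congrArg μ hc.2.symm
        simp only [Fin.val_rev] at h1
        omega
      · refine congrArg Sum.inr (box_ext (Fin.rev_injective hc.2) ?_)
        exact congrArg Fin.val (Fin.rev_injective hc.1)
    · rintro ⟨l, j⟩
      by_cases hl : (l : ℕ) < μ j
      · exact ⟨Sum.inl ⟨j, ⟨l, hl⟩⟩, rfl⟩
      · have h1 := h j
        have h2 := l.2
        refine ⟨Sum.inr ⟨j.rev, ⟨l.rev, by rw [Fin.val_rev]; omega⟩⟩, ?_⟩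
        exact Prod.ext (Fin.rev_rev l) (Fin.rev_rev j))

lemma rectEquiv_inl (h : ∀ j, μ j + μ' j.rev = N) (c : Box μ) :
    (rectEquiv h (Sum.inl c)).2 = c.1 ∧ ((rectEquiv h (Sum.inl c)).1 : ℕ) = c.2 := ⟨rfl, rfl⟩

lemma rectEquiv_inr (h : ∀ j, μ j + μ' j.rev = N) (c : Box μ') :
    (rectEquiv h (Sum.inr c)).2 = c.1.rev ∧
      ((rectEquiv h (Sum.inr c)).1 : ℕ) = N - (c.2 + 1) := ⟨rfl, rfl⟩

variable {K : Type*} [Field K] {E : Type*} [AddCommGroup E] [Module K E]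
  (b : Module.Basis (Fin m) K E)

/-- The pairing of tensor powers for complementary partitions. -/
noncomputable def tensorPairing (h : ∀ j, μ j + μ' j.rev = N) :
    BoxTensor K E μ →ₗ[K] BoxTensor K E μ' →ₗ[K] K :=
  TensorProduct.curry (PiTensorProduct.lift (rectForm b N) ∘ₗ
    (PiTensorProduct.reindex K (fun _ => E) (rectEquiv h)).toLinearMap ∘ₗ
    (PiTensorProduct.tmulEquiv K E).toLinearMap)

lemma tensorPairing_tprod (h : ∀ j, μ j + μ' j.rev = N) (v : Box μ → E) (w : Box μ' → E) :
    tensorPairing b h (PiTensorProduct.tprod K v) (PiTensorProduct.tprod K w) =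
      rectForm b N (Sum.elim v w ∘ (rectEquiv h).symm) := by
  simp only [tensorPairing, TensorProduct.curry_apply, LinearMap.comp_apply, LinearEquiv.coe_coe,
    PiTensorProduct.tmulEquiv_apply, PiTensorProduct.reindex_tprod, PiTensorProduct.lift.tprod]
  rfl

lemma tensorPairing_ext {f f' : BoxTensor K E μ →ₗ[K] BoxTensor K E μ' →ₗ[K] K}
    (h : ∀ v w, f (PiTensorProduct.tprod K v) (PiTensorProduct.tprod K w) =
      f' (PiTensorProduct.tprod K v) (PiTensorProduct.tprod K w)) : f = f' := by
  refine PiTensorProduct.ext (MultilinearMap.ext fun v => ?_)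
  refine PiTensorProduct.ext (MultilinearMap.ext fun w => ?_)
  exact h v w

lemma tensorPairing_tensorRep (h : ∀ j, μ j + μ' j.rev = N) (g : GLin K E)
    (x : BoxTensor K E μ) (y : BoxTensor K E μ') :
    tensorPairing b h (tensorRep K E μ g x) (tensorRep K E μ' g y) =
      LinearMap.det (g : E →ₗ[K] E) ^ N * tensorPairing b h x y := by
  have key : (tensorPairing b h).compl₁₂ (tensorRep K E μ g) (tensorRep K E μ' g) =
      LinearMap.det (g : E →ₗ[K] E) ^ N • tensorPairing b h := by
    refine tensorPairing_ext fun v w => ?_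
    have h1 : ∀ {κ : Fin m → ℕ} (v : Box κ → E), tensorRep K E κ g (PiTensorProduct.tprod K v) =
        PiTensorProduct.tprod K fun c => (g : E →ₗ[K] E) (v c) :=
      fun v => PiTensorProduct.map_tprod _ _
    simp only [LinearMap.compl₁₂_apply, h1, LinearMap.smul_apply, tensorPairing_tprod, smul_eq_mul]
    rw [← rectForm_map]
    congr 1
    funext p
    simp only [Function.comp_apply]
    rcases (rectEquiv h).symm p with c | c <;> rfl
  exact LinearMap.congr_fun (LinearMap.congr_fun key x) y

lemma tensorPairing_permAct (h : ∀ j, μ j + μ' j.rev = N) {σ : Equiv.Perm (Box μ)}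
    (hσ : σ ∈ colPerms μ) {σ' : Equiv.Perm (Box μ')} (hσ' : σ' ∈ colPerms μ')
    (x : BoxTensor K E μ) (y : BoxTensor K E μ') :
    tensorPairing b h (permAct K E μ σ x) (permAct K E μ' σ' y) =
      ((Equiv.Perm.sign σ : ℤ) : K) * ((Equiv.Perm.sign σ' : ℤ) : K) * tensorPairing b h x y := by
  have key : (tensorPairing b h).compl₁₂ (permAct K E μ σ) (permAct K E μ' σ') =
      (((Equiv.Perm.sign σ : ℤ) : K) * ((Equiv.Perm.sign σ' : ℤ) : K)) • tensorPairing b h := by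
    refine tensorPairing_ext fun v w => ?_
    have h1 : ∀ c, ((σ c).2 : ℕ) = c.2 := by simpa [colPerms] using hσ
    have h2 : ∀ c, ((σ' c).2 : ℕ) = c.2 := by simpa [colPerms] using hσ'
    simp only [LinearMap.compl₁₂_apply, permAct_tprod, LinearMap.smul_apply, tensorPairing_tprod,
      smul_eq_mul]
    let τ : Equiv.Perm (Fin N × Fin m) := (rectEquiv h).permCongr (Equiv.sumCongr σ σ')
    have hτ : ∀ p, (τ p).1 = p.1 := by
      intro p
      obtain ⟨c, rfl⟩ := (rectEquiv h).surjective p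
      have e : τ (rectEquiv h c) = rectEquiv h (Equiv.sumCongr σ σ' c) := by
        simp [τ]
      rw [e]
      refine Fin.ext ?_
      rcases c with c | c
      · exact (rectEquiv_inl h (σ c)).2.trans ((h1 c).trans (rectEquiv_inl h c).2.symm)
      · change ((rectEquiv h (Sum.inr (σ' c))).1 : ℕ) = _
        rw [(rectEquiv_inr h (σ' c)).2, (rectEquiv_inr h c).2, h2]
    have hs : Equiv.Perm.sign τ = Equiv.Perm.sign σ * Equiv.Perm.sign σ' := by
      rw [Equiv.Perm.sign_permCongr]
      exact Equiv.Perm.sign_sumCongr σ σ'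
    have e := rectForm_perm b N τ hτ
      (Sum.elim (v ∘ σ.symm) (w ∘ σ'.symm) ∘ (rectEquiv h).symm)
    have e2 : (Sum.elim (v ∘ σ.symm) (w ∘ σ'.symm) ∘ (rectEquiv h).symm) ∘ τ =
        Sum.elim v w ∘ (rectEquiv h).symm := by
      funext p
      obtain ⟨c, rfl⟩ := (rectEquiv h).surjective p
      rcases c with c | c <;> simp [τ]
    rw [e2, hs] at e
    rw [e]
    have hsq : ∀ u : ℤˣ, ((u : ℤ) : K) * ((u : ℤ) : K) = 1 := fun u => by
      rw [← Int.cast_mul, ← Units.val_mul, Int.units_mul_self]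
      simp
    rw [Units.val_mul, Int.cast_mul, ← mul_assoc, mul_mul_mul_comm, hsq, hsq, one_mul, one_mul]
  exact LinearMap.congr_fun (LinearMap.congr_fun key x) y

/-- The pairing is already alternating along columns, so all summands contribute equally. -/
lemma tensorPairing_colAlt_right (h : ∀ j, μ j + μ' j.rev = N)
    (x : BoxTensor K E μ) (y : BoxTensor K E μ') :
    tensorPairing b h x (colAlt K E μ' y) = ((colPerms μ').card : K) * tensorPairing b h x y := by
  rw [colAlt, LinearMap.sum_apply, map_sum, ← nsmul_eq_mul, ← Finset.sum_const]
  refine Finset.sum_congr rfl fun σ hσ => ?_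
  have e := tensorPairing_permAct b h (colPerms_isSigned μ).one_mem hσ x y
  have e1 : permAct K E μ 1 x = x := by
    refine tcoord_ext b fun S => ?_
    rw [tcoord_permAct]
    rfl
  rw [e1, Equiv.Perm.sign_one] at e
  have hsq : ((Equiv.Perm.sign σ : ℤ) : K) * ((Equiv.Perm.sign σ : ℤ) : K) = 1 := by
    rw [← Int.cast_mul, ← Units.val_mul, Int.units_mul_self]
    simp
  rw [LinearMap.smul_apply, map_smul, e, Units.val_one, Int.cast_one, one_mul,
    smul_eq_mul, ← mul_assoc, hsq, one_mul]

/-- The filling with constant rows, in the reversed order. -/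
def revFill (μ' : Fin m → ℕ) : Box μ' → Fin m := fun c => c.1.rev

lemma tensorPairing_tBasis (h : ∀ j, μ j + μ' j.rev = N) (S : Box μ → Fin m) (S' : Box μ' → Fin m) :
    tensorPairing b h (tBasis b μ S) (tBasis b μ' S') =
      rectForm b N (fun p => b ((Sum.elim S S' ∘ (rectEquiv h).symm) p)) := by
  rw [tBasis_apply, tBasis_apply, tensorPairing_tprod]
  congr 1
  funext p
  simp only [Function.comp_apply]
  rcases (rectEquiv h).symm p with c | c <;> rfl

lemma tensorPairing_rowFill (h : ∀ j, μ j + μ' j.rev = N) :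
    tensorPairing b h (tBasis b μ (rowFill μ)) (tBasis b μ' (revFill μ')) = 1 := by
  rw [tensorPairing_tBasis]
  have : ∀ p, (Sum.elim (rowFill μ) (revFill μ') ∘ (rectEquiv h).symm) p = p.2 := by
    intro p
    obtain ⟨c, rfl⟩ := (rectEquiv h).surjective p
    simp only [Function.comp_apply, Equiv.symm_apply_apply]
    rcases c with c | c <;> rfl
  simp only [this]
  rw [rectForm_apply]
  exact Finset.prod_eq_one fun l _ => b.det_self

/-- Each column of the rectangle must carry distinct basis vectors. Its boxes from the rotated `μ'`
carry their own row index, so `S` has to permute the row indices of the remaining boxes, those of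
`μ`. -/
lemma exists_colPerm_of_tensorPairing (h : ∀ j, μ j + μ' j.rev = N) (S : Box μ → Fin m)
    (hS : tensorPairing b h (tBasis b μ S) (tBasis b μ' (revFill μ')) ≠ 0) :
    ∃ σ ∈ colPerms μ, S = rowFill μ ∘ σ := by
  rw [tensorPairing_tBasis] at hS
  set φ := Sum.elim S (revFill μ') ∘ (rectEquiv h).symm with hφ
  have hinj := rectForm_basis b N φ hS
  have hl : ∀ c : Box μ, (c.2 : ℕ) < N := fun c => by
    have := h c.1
    have := c.2.2
    omega
  have h1 : ∀ c : Box μ, φ (⟨c.2, hl c⟩, c.1) = S c := by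
    intro c
    have : ((⟨c.2, hl c⟩, c.1) : Fin N × Fin m) = rectEquiv h (Sum.inl c) := rfl
    rw [this, hφ]
    simp
  refine ColInj.exists_colPerm (fun c c' hc hcS => ?_) fun c => ?_
  · refine box_ext (hinj ⟨c.2, hl c⟩ ?_) hc
    have : (⟨c.2, hl c⟩ : Fin N) = ⟨c'.2, hl c'⟩ := Fin.ext hc
    simp only
    rw [h1, this, h1, hcS]
  · by_contra hlt
    have h2 : φ (⟨c.2, hl c⟩, S c) = S c := by
      obtain ⟨d, hd⟩ := (rectEquiv h).surjective (⟨c.2, hl c⟩, S c)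
      rw [← hd, hφ]
      simp only [Function.comp_apply, Equiv.symm_apply_apply]
      rcases d with d | d
      · have e1 : d.1 = S c := congrArg Prod.snd hd
        have e2 : (d.2 : ℕ) = c.2 := congrArg (fun p : Fin N × Fin m => (p.1 : ℕ)) hd
        have e3 := d.2.2
        have e4 : μ d.1 = μ (S c) := congrArg μ e1
        omega
      · exact congrArg Prod.snd hd
    have h3 : c.1 = S c := hinj ⟨c.2, hl c⟩ ((h1 c).trans h2.symm)
    rw [← h3] at hlt
    exact hlt c.2.2

/-- Pairing with the reversed filling recovers the highest weight coordinate; this links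
nondegeneracy to `eq_zero_of_hwCoord`. -/
lemma tensorPairing_revFill (h : ∀ j, μ j + μ' j.rev = N) (x : BoxTensor K E μ) :
    tensorPairing b h x (tBasis b μ' (revFill μ')) = tcoord b (colAlt K E μ x) (rowFill μ) := by
  classical
  have key : (tensorPairing b h).flip (tBasis b μ' (revFill μ')) =
      (tBasis b μ).coord (rowFill μ) ∘ₗ colAlt K E μ := by
    refine (tBasis b μ).ext fun S => ?_
    rw [LinearMap.flip_apply, LinearMap.comp_apply]
    change _ = tcoord b (colAlt K E μ (tBasis b μ S)) (rowFill μ)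
    by_cases hS : ∃ σ ∈ colPerms μ, S = rowFill μ ∘ σ
    · obtain ⟨σ, hσ, rfl⟩ := hS
      have hσ1 := (colPerms_isSigned μ).inv_mem hσ
      have e : tBasis b μ (rowFill μ ∘ σ) = permAct K E μ σ⁻¹ (tBasis b μ (rowFill μ)) := by
        rw [permAct_tBasis]
        rfl
      have e1 : permAct K E μ' 1 (tBasis b μ' (revFill μ')) = tBasis b μ' (revFill μ') := by
        rw [permAct_tBasis]
        rfl
      have e2 := tensorPairing_permAct b h hσ1 (colPerms_isSigned μ').one_mem
        (tBasis b μ (rowFill μ)) (tBasis b μ' (revFill μ'))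
      rw [e1, tensorPairing_rowFill] at e2
      rw [e, e2, ← e, tcoord_colAlt, permSum, Finset.sum_eq_single σ]
      · rw [tcoord_tBasis, if_pos rfl]
        simp
      · intro τ hτ hne
        rw [tcoord_tBasis, if_neg, smul_zero]
        intro heq
        refine hne (Equiv.ext fun c => ?_)
        have hσ' : ∀ c, ((σ c).2 : ℕ) = c.2 := by simpa [colPerms] using hσ
        have hτ' : ∀ c, ((τ c).2 : ℕ) = c.2 := by simpa [colPerms] using hτ
        exact box_ext (congr_fun heq c).symm ((hτ' c).trans (hσ' c).symm)
      · exact fun h => absurd hσ h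
    · rw [tcoord_colAlt, permSum, Finset.sum_eq_zero]
      · by_contra hne
        exact hS (exists_colPerm_of_tensorPairing b h S hne)
      · intro σ hσ
        rw [tcoord_tBasis, if_neg fun heq => hS ⟨σ, hσ, heq⟩, smul_zero]
  exact LinearMap.congr_fun key x

/-- The pairing of Schur modules for complementary partitions. -/
noncomputable def schurPairing (h : ∀ j, μ j + μ' j.rev = N) :
    SchurModule K E μ →ₗ[K] SchurModule K E μ' →ₗ[K] K :=
  (tensorPairing b h).compl₁₂ (LinearMap.range (youngSymmetrizer K E μ)).subtype
    (LinearMap.range (youngSymmetrizer K E μ')).subtype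

lemma schurPairing_schurRep (h : ∀ j, μ j + μ' j.rev = N) (g : GLin K E)
    (x : SchurModule K E μ) (y : SchurModule K E μ') :
    schurPairing b h (schurRep K E μ g x) (schurRep K E μ' g y) =
      LinearMap.det (g : E →ₗ[K] E) ^ N * schurPairing b h x y :=
  tensorPairing_tensorRep b h g x y

variable [CharZero K]

/-- Up to a nonzero factor `hwCoord` is pairing with one fixed vector `y'`. By equivariance, a
vector orthogonal to everything has all its translates in the kernel of `hwCoord`. -/
lemma schurPairing_separatingLeft (h : ∀ j, μ j + μ' j.rev = N) (hμ : Antitone μ) :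
    (schurPairing (K := K) (E := E) b h).SeparatingLeft := by
  intro x hx
  refine eq_zero_of_hwCoord b hμ x fun X hX _ _ => ?_
  let y' : SchurModule K E μ' := ⟨youngSymmetrizer K E μ' (tBasis b μ' (revFill μ')), _, rfl⟩
  have hy : (y' : BoxTensor K E μ') =
      ((rowPerms μ').card : K) • colAlt K E μ' (tBasis b μ' (revFill μ')) := by
    simp only [y']
    rw [youngSymmetrizer_apply, rowSym_tBasis b, map_smul]
    intro ρ hρ
    have hρ' : ∀ c, (ρ c).1 = c.1 := by simpa [rowPerms] using hρ
    exact funext fun c => congrArg Fin.rev (hρ' c)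
  have h1 : ∀ z : SchurModule K E μ, schurPairing b h z y' =
      ((rowPerms μ').card : K) * (((colPerms μ').card : K) *
        (((colPerms μ).card : K) * hwCoord b μ z)) := by
    intro z
    change tensorPairing b h (z : BoxTensor K E μ) (y' : BoxTensor K E μ') = _
    rw [hy, map_smul, tensorPairing_colAlt_right, smul_eq_mul, tensorPairing_revFill]
    have hz : colAlt K E μ (z : BoxTensor K E μ) = ((colPerms μ).card : K) • (z : BoxTensor K E μ) := by
      obtain ⟨_, y, rfl⟩ := z
      exact colAlt_of_comp b _ fun τ hτ S => colAlt_comp b _ hτ S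
    rw [hz, tcoord_smul, hwCoord_apply]
    rfl
  have h2 := h1 (schurRep K E μ (matGL b X hX) x)
  have h3 := schurPairing_schurRep b h (matGL b X hX) x (schurRep K E μ' (matGL b X hX)⁻¹ y')
  rw [Representation.self_inv_apply, hx, mul_zero] at h3
  rw [h3] at h2
  have h4 := (mul_eq_zero.1 h2.symm).resolve_left card_rowPerms_ne_zero
  have h5 := (mul_eq_zero.1 h4).resolve_left card_colPerms_ne_zero
  exact (mul_eq_zero.1 h5).resolve_left card_colPerms_ne_zero

/-- Left separation for `(μ, μ')` and for `(μ', μ)` bounds the dimensions both ways, so no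
comparison of the two pairings is needed. -/
lemma schurPairing_nondegenerate (h : ∀ j, μ j + μ' j.rev = N) (hμ : Antitone μ)
    (hμ' : Antitone μ') : (schurPairing (K := K) (E := E) b h).Nondegenerate := by
  have h' : ∀ j, μ' j + μ j.rev = N := fun j => by
    have := h j.rev
    rw [Fin.rev_rev] at this
    omega
  have f1 : FiniteDimensional K (BoxTensor K E μ) := Module.Finite.of_basis (tBasis b μ)
  have f2 : FiniteDimensional K (BoxTensor K E μ') := Module.Finite.of_basis (tBasis b μ')
  have i1 : Function.Injective (schurPairing (K := K) (E := E) b h) :=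
    LinearMap.ker_eq_bot.1 (LinearMap.separatingLeft_iff_ker_eq_bot.1
      (schurPairing_separatingLeft b h hμ))
  have i2 : Function.Injective (schurPairing (K := K) (E := E) b h') :=
    LinearMap.ker_eq_bot.1 (LinearMap.separatingLeft_iff_ker_eq_bot.1
      (schurPairing_separatingLeft b h' hμ'))
  have d1 := LinearMap.finrank_le_finrank_of_injective i1
  have d2 := LinearMap.finrank_le_finrank_of_injective i2
  rw [Subspace.dual_finrank_eq] at d1 d2
  have hs : Function.Surjective (schurPairing (K := K) (E := E) b h) := by
    refine (LinearMap.injective_iff_surjective_of_finrank_eq_finrank ?_).1 i1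
    rw [Subspace.dual_finrank_eq]
    exact le_antisymm d1 d2
  refine ⟨schurPairing_separatingLeft b h hμ, fun y hy => ?_⟩
  refine (Module.forall_dual_apply_eq_zero_iff K y).1 fun θ => ?_
  obtain ⟨x, rfl⟩ := hs θ
  exact hy x

end Complement

/-! ### Arithmetic of the weights `α(d, i)`. -/

section Arithmetic

variable {m : ℕ} {d : Fin (m + 1) → ℤ}

lemma sum_diffSeq {m : ℕ} (d : Fin (m + 1) → ℤ) :
    ∑ k, diffSeq d k = d (Fin.last m) - d 0 := by
  induction m with
  | zero => simp
  | succ m ih =>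
    rw [Fin.sum_univ_castSucc]
    have h := ih fun i => d i.castSucc
    have h2 : ∀ k : Fin m, diffSeq d k.castSucc = diffSeq (fun i => d i.castSucc) k := fun k => rfl
    rw [Finset.sum_congr rfl fun k _ => h2 k, h]
    simp [diffSeq]

/-- The width `c - 2 d_0` of the rectangle is nonnegative, so `toNat` loses nothing. -/
lemma le_dualWeight (hd : StrictMono d) : 2 * d 0 ≤ dualWeight d := by
  have h : ∑ _k : Fin m, (1 : ℤ) ≤ ∑ k, diffSeq d k :=
    Finset.sum_le_sum fun k _ => diffSeq_pos hd k
  rw [sum_diffSeq] at h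
  simp only [Finset.sum_const, Finset.card_univ, Fintype.card_fin, nsmul_eq_mul, mul_one] at h
  unfold dualWeight
  linarith

/-- Symmetry turns the sum over `k > j.rev` into one over `k < j`; together with the sum over `k >
j` only the term at `j` of the full sum `d_m - d_0 - m` is missing. -/
lemma lam_add_lam_rev (hsymm : ∀ j : Fin m, diffSeq d j = diffSeq d j.rev) (j : Fin m) :
    lam d j + lam d j.rev + diffSeq d j = dualWeight d := by
  have h1 : ∑ k ∈ Finset.Ioi j.rev, (diffSeq d k - 1) = ∑ k ∈ Finset.Iio j, (diffSeq d k - 1) := by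
    refine Finset.sum_bij' (fun k _ => k.rev) (fun k _ => k.rev) ?_ ?_ (by simp) (by simp) ?_
    · intro k hk
      simpa [Fin.rev_lt_iff] using hk
    · intro k hk
      simpa using hk
    · intro k _
      rw [← hsymm]
  have h2 : ∑ k, (diffSeq d k - 1) = ∑ k ∈ Finset.Iio j, (diffSeq d k - 1) + (diffSeq d j - 1) +
      ∑ k ∈ Finset.Ioi j, (diffSeq d k - 1) := by
    rw [← Finset.sum_filter_add_sum_filter_not Finset.univ (fun k => k < j)]
    have e1 : Finset.univ.filter (fun k => k < j) = Finset.Iio j := by ext; simp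
    have e2 : Finset.univ.filter (fun k => ¬ k < j) = insert j (Finset.Ioi j) := by
      rw [Finset.Ioi_insert]
      ext; simp
    rw [e1, e2, Finset.sum_insert (by simp)]
    ring
  have h3 : ∑ k, (diffSeq d k - 1) = d (Fin.last m) - d 0 - m := by
    rw [Finset.sum_sub_distrib, sum_diffSeq]
    simp
  unfold lam dualWeight
  rw [h1]
  linarith

lemma alpha_add_alpha (hsymm : ∀ j : Fin m, diffSeq d j = diffSeq d j.rev) (i i' : Fin (m + 1))
    (h : (i : ℕ) + i' = m) (j : Fin m) :
    alpha d i j + alpha d i' j.rev = dualWeight d := by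
  have h1 := lam_add_lam_rev hsymm j
  have h2 := hsymm j
  have h3 : (j.rev : ℕ) = m - (j + 1) := Fin.val_rev j
  have h4 := j.2
  unfold alpha
  by_cases hj : (j : ℕ) < i
  · rw [if_pos hj, if_neg (by omega)]
    linarith
  · rw [if_neg hj, if_pos (by omega)]
    linarith

lemma degree_add_degree (hsymm : ∀ j : Fin m, diffSeq d j = diffSeq d j.rev) (i i' : Fin (m + 1))
    (h : (i : ℕ) + i' = m) : d i + d i' = d 0 + d (Fin.last m) := by
  induction i using Fin.induction generalizing i' with
  | zero =>
    congr 2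
    exact Fin.ext (by simpa using h)
  | succ k ih =>
    have hk : (k : ℕ) + 1 + i' = m := h
    have h1 := ih k.rev.succ (by simp [Fin.val_rev]; omega)
    have h2 : i' = k.rev.castSucc := Fin.ext (by simp [Fin.val_rev]; omega)
    have h3 := hsymm k
    unfold diffSeq at h3
    rw [h2]
    linarith

/-- The slack that makes all `α(d, i)` decreasing: `λ_{j'} + e_{j'}` exceeds `λ_j` by at most one,
and when row `j'` has received its boxes, row `j` has received `e_j ≥ 1`. -/
lemma lam_lt (hd : StrictMono d) {j j' : Fin m} (h : j < j') :
    lam d j' + diffSeq d j' - 1 ≤ lam d j := by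
  have h1 : insert j' (Finset.Ioi j') ⊆ Finset.Ioi j := by
    rw [Finset.Ioi_insert]
    intro k hk
    exact Finset.mem_Ioi.2 (h.trans_le (Finset.mem_Ici.1 hk))
  have h2 := Finset.sum_le_sum_of_subset_of_nonneg h1
    (f := fun k => diffSeq d k - 1) fun k _ _ => by linarith [diffSeq_pos hd k]
  rw [Finset.sum_insert (by simp)] at h2
  unfold lam
  linarith

lemma shape_antitone (hd : StrictMono d) (i : Fin (m + 1)) : Antitone (shape d i) := by
  intro j j' h
  rcases h.eq_or_lt with rfl | h
  · exact le_rfl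
  have h1 := shape_cast hd i j
  have h2 := shape_cast hd i j'
  have h3 := lam_lt hd h
  have h4 := diffSeq_pos hd j
  have h5 := diffSeq_pos hd j'
  have h6 : (j : ℕ) < j' := h
  have h7 : alpha d i j' ≤ alpha d i j := by
    unfold alpha
    split_ifs <;> omega
  omega

lemma shape_add_shape (hd : StrictMono d) (hsymm : ∀ j : Fin m, diffSeq d j = diffSeq d j.rev)
    (i i' : Fin (m + 1)) (h : (i : ℕ) + i' = m) (j : Fin m) :
    shape d i j + shape d i' j.rev = (dualWeight d - 2 * d 0).toNat := by
  have h1 := shape_cast hd i j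
  have h2 := shape_cast hd i' j.rev
  have h3 := alpha_add_alpha hsymm i i' h j
  omega

lemma shape_succ_of_ne (k j : Fin m) (hj : j ≠ k) :
    shape d k.succ j = shape d k.castSucc j := by
  have : (j : ℕ) < k.succ ↔ (j : ℕ) < k.castSucc := by
    have := Fin.val_ne_of_ne hj
    simp only [Fin.val_succ, Fin.val_castSucc]
    omega
  simp only [shape, alpha, this]

lemma shape_succ_self (hd : StrictMono d) (k : Fin m) :
    (shape d k.succ k : ℤ) = shape d k.castSucc k + diffSeq d k := by
  rw [shape_cast hd, shape_cast hd]
  simp [alpha]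
  ring

lemma shape_le_succ (hd : StrictMono d) (k j : Fin m) :
    shape d k.castSucc j ≤ shape d k.succ j := by
  rcases eq_or_ne j k with rfl | hj
  · have := shape_succ_self hd j
    have := diffSeq_pos hd j
    omega
  · exact (shape_succ_of_ne k j hj).ge

/-- For adjacent rows the bound of `lam_lt` is attained. This is the overlap in a single column that
makes consecutive differentials compose to zero. -/
lemma shape_overlap (hd : StrictMono d) (k : ℕ) (h : k + 1 < m) :
    shape d (Fin.succ ⟨k + 1, h⟩) ⟨k + 1, h⟩ =
      shape d (Fin.castSucc ⟨k, by omega⟩) ⟨k, by omega⟩ + 1 := by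
  have h1 := shape_cast hd (Fin.succ ⟨k + 1, h⟩) ⟨k + 1, h⟩
  have h2 := shape_cast hd (Fin.castSucc ⟨k, by omega⟩) ⟨k, by omega⟩
  have h3 : lam d ⟨k, by omega⟩ = lam d ⟨k + 1, h⟩ + (diffSeq d ⟨k + 1, h⟩ - 1) := by
    have : Finset.Ioi (⟨k, by omega⟩ : Fin m) =
        insert ⟨k + 1, h⟩ (Finset.Ioi (⟨k + 1, h⟩ : Fin m)) := by
      rw [Finset.Ioi_insert]
      ext j
      simp only [Finset.mem_Ioi, Finset.mem_Ici, Fin.lt_def, Fin.le_def]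
      omega
    unfold lam
    rw [this, Finset.sum_insert (by simp)]
    ring
  have h4 : alpha d (Fin.succ ⟨k + 1, h⟩) ⟨k + 1, h⟩ =
      lam d ⟨k + 1, h⟩ + diffSeq d ⟨k + 1, h⟩ := by simp [alpha]
  have h5 : alpha d (Fin.castSucc ⟨k, by omega⟩) ⟨k, by omega⟩ = lam d ⟨k, by omega⟩ := by
    simp [alpha]
  omega

end Arithmetic

/-! ### Duals of free modules `A ⊗ W` through a perfect pairing. -/

section DualBaseChange

variable {K : Type*} [Field K] {A V W : Type*} [CommRing A] [Algebra K A] [AddCommGroup V]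
  [Module K V] [AddCommGroup W] [Module K W]

/-- The map `A ⊗ V → Hom_A(A ⊗ W, A)` induced by a pairing of `V` and `W`. -/
noncomputable def dualMap (A : Type*) [CommRing A] [Algebra K A] (β : V →ₗ[K] W →ₗ[K] K) :
    A ⊗[K] V →ₗ[A] Module.Dual A (A ⊗[K] W) :=
  LinearMap.liftBaseChange A
    ((LinearMap.liftBaseChangeEquiv A).toLinearMap.restrictScalars K ∘ₗ
      LinearMap.compRight K (Algebra.linearMap K A) ∘ₗ β)

lemma dualMap_tmul (β : V →ₗ[K] W →ₗ[K] K) (a a' : A) (s : V) (t : W) :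
    dualMap A β (a ⊗ₜ s) (a' ⊗ₜ t) = a * a' * algebraMap K A (β s t) := by
  simp [dualMap, mul_assoc]

/-- An element is recovered from its functional by dual bases; injectivity, surjectivity and the
degree criterion all follow from this. -/
lemma sum_dualMap_tmul {β : V →ₗ[K] W →ₗ[K] K} {ι : Type*} [Fintype ι] (u : ι → V) (w : ι → W)
    (h : ∀ s, ∑ q, β s (w q) • u q = s) (x : A ⊗[K] V) :
    ∑ q, dualMap A β x (1 ⊗ₜ w q) ⊗ₜ[K] u q = x := by
  induction x using TensorProduct.induction_on with
  | zero => simp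
  | tmul a s =>
    conv_rhs => rw [← h s, TensorProduct.tmul_sum]
    refine Finset.sum_congr rfl fun q _ => ?_
    rw [dualMap_tmul, mul_one, TensorProduct.tmul_smul, TensorProduct.smul_tmul',
      Algebra.smul_def, mul_comm]
  | add x y hx hy =>
    simp only [map_add, LinearMap.add_apply, TensorProduct.add_tmul, Finset.sum_add_distrib, hx, hy]

variable [FiniteDimensional K V] [FiniteDimensional K W]

lemma exists_dual_basis {β : V →ₗ[K] W →ₗ[K] K} (hβ : β.Nondegenerate) :
    ∃ (u : Fin (Module.finrank K W) → V) (w : Module.Basis (Fin (Module.finrank K W)) K W),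
      (∀ p q, β (u p) (w q) = if p = q then 1 else 0) ∧ ∀ s, ∑ q, β s (w q) • u q = s := by
  have i1 : Function.Injective β :=
    LinearMap.ker_eq_bot.1 (LinearMap.separatingLeft_iff_ker_eq_bot.1 hβ.1)
  have i2 : Function.Injective β.flip :=
    LinearMap.ker_eq_bot.1 (LinearMap.separatingRight_iff_flip_ker_eq_bot.1 hβ.2)
  have d1 := LinearMap.finrank_le_finrank_of_injective i1
  have d2 := LinearMap.finrank_le_finrank_of_injective i2
  rw [Subspace.dual_finrank_eq] at d1 d2
  have hs : Function.Surjective β := by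
    refine (LinearMap.injective_iff_surjective_of_finrank_eq_finrank ?_).1 i1
    rw [Subspace.dual_finrank_eq]
    exact le_antisymm d1 d2
  let w := Module.finBasis K W
  choose u hu using fun p => hs (w.coord p)
  have h1 : ∀ p q, β (u p) (w q) = if p = q then 1 else 0 := fun p q => by
    rw [hu, Module.Basis.coord_apply, Module.Basis.repr_self, Finsupp.single_apply]
    simp only [eq_comm]
  refine ⟨u, w, h1, fun s => i1 (w.ext fun r => ?_)⟩
  simp [h1]

lemma dualMap_bijective {β : V →ₗ[K] W →ₗ[K] K} (hβ : β.Nondegenerate) :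
    Function.Bijective (dualMap A β) := by
  obtain ⟨u, w, h1, h2⟩ := exists_dual_basis hβ
  constructor
  · rw [injective_iff_map_eq_zero]
    intro x hx
    rw [← sum_dualMap_tmul u w h2 x, hx]
    simp
  · intro f
    refine ⟨∑ q, f (1 ⊗ₜ w q) ⊗ₜ[K] u q, ?_⟩
    refine (w.baseChange A).ext fun r => ?_
    rw [Module.Basis.baseChange_apply, map_sum, LinearMap.sum_apply]
    simp only [dualMap_tmul, h1]
    simp

/-- The isomorphism `A ⊗ V ≅ Hom_A(A ⊗ W, A)` induced by a nondegenerate pairing. -/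
noncomputable def dualEquiv (A : Type*) [CommRing A] [Algebra K A] {β : V →ₗ[K] W →ₗ[K] K}
    (hβ : β.Nondegenerate) : A ⊗[K] V ≃ₗ[A] Module.Dual A (A ⊗[K] W) :=
  LinearEquiv.ofBijective (dualMap A β) (dualMap_bijective hβ)

lemma mem_range_map_iff {β : V →ₗ[K] W →ₗ[K] K} (hβ : β.Nondegenerate) (Q : Submodule K A)
    (x : A ⊗[K] V) :
    x ∈ LinearMap.range (TensorProduct.map Q.subtype (LinearMap.id : V →ₗ[K] V)) ↔
      ∀ t, dualMap A β x (1 ⊗ₜ t) ∈ Q := by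
  constructor
  · rintro ⟨y, rfl⟩ t
    induction y using TensorProduct.induction_on with
    | zero => simp
    | tmul a s =>
      rw [TensorProduct.map_tmul, dualMap_tmul, mul_one, mul_comm, ← Algebra.smul_def]
      exact Q.smul_mem _ a.2
    | add x y hx hy =>
      rw [map_add, map_add, LinearMap.add_apply]
      exact Q.add_mem hx hy
  · intro h
    obtain ⟨u, w, -, h2⟩ := exists_dual_basis hβ
    rw [← sum_dualMap_tmul u w h2 x]
    exact Submodule.sum_mem _ fun q _ => ⟨⟨_, h (w q)⟩ ⊗ₜ u q, TensorProduct.map_tmul _ _ _ _⟩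

end DualBaseChange

/-! ### Gradings on `Sym E`, on the terms and on their duals. -/

section Degrees

variable {K : Type*} [Field K] {E : Type*} [AddCommGroup E] [Module K E]

lemma symDeg_mul_mem {p q : ℤ} {x y : PolyRing K E} (hx : x ∈ symDeg K E p)
    (hy : y ∈ symDeg K E q) : x * y ∈ symDeg K E (p + q) := by
  unfold symDeg at *
  by_cases hp : 0 ≤ p
  · by_cases hq : 0 ≤ q
    · rw [if_pos hp] at hx
      rw [if_pos hq] at hy
      rw [if_pos (by omega), Int.toNat_add hp hq, pow_add]
      exact Submodule.mul_mem_mul hx hy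
    · rw [if_neg hq, Submodule.mem_bot] at hy
      rw [hy, mul_zero]
      exact Submodule.zero_mem _
  · rw [if_neg hp, Submodule.mem_bot] at hx
    rw [hx, zero_mul]
    exact Submodule.zero_mem _

lemma one_mem_symDeg : (1 : PolyRing K E) ∈ symDeg K E 0 := by
  simp [symDeg]

variable {m : ℕ} {d : Fin (m + 1) → ℤ}

lemma one_tmul_mem_termDeg (i : Fin (m + 1)) (s : Gen K E d i) :
    (1 : PolyRing K E) ⊗ₜ[K] s ∈ termDeg K E d i (d i) := by
  refine ⟨⟨1, ?_⟩ ⊗ₜ s, TensorProduct.map_tmul _ _ _ _⟩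
  rw [sub_self]
  exact one_mem_symDeg

lemma smul_mem_termDeg {i : Fin (m + 1)} {p q : ℤ} {a : PolyRing K E} (ha : a ∈ symDeg K E p)
    {x : Term K E d i} (hx : x ∈ termDeg K E d i q) : a • x ∈ termDeg K E d i (p + q) := by
  obtain ⟨y, rfl⟩ := hx
  induction y using TensorProduct.induction_on with
  | zero => simp
  | tmul c s =>
    refine ⟨⟨a * c, ?_⟩ ⊗ₜ s, ?_⟩
    · rw [add_sub_assoc]
      exact symDeg_mul_mem ha c.2
    · rw [TensorProduct.map_tmul, TensorProduct.map_tmul, TensorProduct.smul_tmul']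
      rfl
  | add x y hx hy =>
    rw [map_add, smul_add]
    exact Submodule.add_mem _ hx hy

lemma isDualHomogeneous_iff (i : Fin (m + 1)) (n : ℤ) (f : DualTerm K E d i) :
    IsDualHomogeneous K E d i n f ↔ ∀ t, f (1 ⊗ₜ t) ∈ symDeg K E (d i + n) := by
  constructor
  · intro h t
    exact h _ _ (one_tmul_mem_termDeg i t)
  · rintro h k _ ⟨y, rfl⟩
    induction y using TensorProduct.induction_on with
    | zero => simp
    | tmul c s =>
      have e : TensorProduct.map (symDeg K E (k - d i)).subtype LinearMap.id (c ⊗ₜ s) =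
          (c : PolyRing K E) • ((1 : PolyRing K E) ⊗ₜ[K] s) := by
        rw [TensorProduct.map_tmul, TensorProduct.smul_tmul', smul_eq_mul, mul_one]
        rfl
      rw [e, map_smul, smul_eq_mul]
      have := symDeg_mul_mem c.2 (h s)
      rwa [← add_assoc, sub_add_cancel] at this
    | add x y hx hy =>
      rw [map_add, map_add]
      exact Submodule.add_mem _ hx hy

end Degrees

lemma linearEquiv_map_smul_of_tower {K A M N : Type*} [CommSemiring K] [Semiring A] [Algebra K A]
    [AddCommMonoid M] [AddCommMonoid N] [Module K M] [Module A M] [IsScalarTower K A M]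
    [Module K N] [Module A N] [IsScalarTower K A N] (e : M ≃ₗ[A] N) (c : K) (x : M) :
    e (c • x) = c • e x := LinearMap.map_smul_of_tower e.toLinearMap c x

/-! ### Restricting module maps to the generators. -/

section Restriction

variable {K : Type*} [Field K] {E : Type*} [AddCommGroup E] [Module K E] {m : ℕ}
  {d : Fin (m + 1) → ℤ}

lemma detPow_ne_zero (p : ℤ) (g : GLin K E) : detPow K E p g ≠ 0 := by
  have h : detPow K E p g * detPow K E p g⁻¹ = 1 := by rw [← map_mul, mul_inv_cancel, map_one]
  exact left_ne_zero_of_mul_eq_one h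

lemma termRep_eq (i : Fin (m + 1)) (g : GLin K E) (x : Term K E d i) :
    termRep K E d i g x = detPow K E (d 0) g •
      TensorProduct.map (symMap K E g).toLinearMap (schurRep K E (shape d i) g) x := by
  induction x using TensorProduct.induction_on with
  | zero => simp
  | tmul a s =>
    rw [TensorProduct.map_tmul, ← TensorProduct.tmul_smul]
    rfl
  | add x y hx hy => rw [map_add, map_add, smul_add, hx, hy]

/-- The restriction of an `A`-linear map to the space of generators. -/
noncomputable def genMap {i j : Fin (m + 1)} (φ : Term K E d i →ₗ[PolyRing K E] Term K E d j) :
    Gen K E d i →ₗ[K] Term K E d j :=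
  φ.restrictScalars K ∘ₗ TensorProduct.mk K (PolyRing K E) (Gen K E d i) 1

lemma genMap_apply {i j : Fin (m + 1)} (φ : Term K E d i →ₗ[PolyRing K E] Term K E d j)
    (s : Gen K E d i) : genMap φ s = φ (1 ⊗ₜ s) := rfl

lemma genMap_injective {i j : Fin (m + 1)} {φ ψ : Term K E d i →ₗ[PolyRing K E] Term K E d j}
    (h : genMap φ = genMap ψ) : φ = ψ := by
  refine TensorProduct.AlgebraTensorModule.ext fun a s => ?_
  have e : a ⊗ₜ[K] s = a • ((1 : PolyRing K E) ⊗ₜ[K] s) := by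
    rw [TensorProduct.smul_tmul', smul_eq_mul, mul_one]
  rw [e, map_smul, map_smul]
  congr 1
  exact LinearMap.congr_fun h s

/-- Source and target carry the same twist `det^{d_0}`, which cancels. -/
lemma genMap_isEquivariant {i j : Fin (m + 1)} {φ : Term K E d i →ₗ[PolyRing K E] Term K E d j}
    (h : ∀ g x, φ (termRep K E d i g x) = termRep K E d j g (φ x)) : IsEquivariant (genMap φ) := by
  intro g s
  have h1 := h g (1 ⊗ₜ s)
  rw [termRep_eq, termRep_eq, TensorProduct.map_tmul, AlgHom.toLinearMap_apply, map_one,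
    LinearMap.map_smul_of_tower] at h1
  exact smul_right_injective _ (detPow_ne_zero (d 0) g) h1

lemma equivariant_of_genMap {i j : Fin (m + 1)} {φ : Term K E d i →ₗ[PolyRing K E] Term K E d j}
    (h : IsEquivariant (genMap φ)) (g : GLin K E) (x : Term K E d i) :
    φ (termRep K E d i g x) = termRep K E d j g (φ x) := by
  induction x using TensorProduct.induction_on with
  | zero => simp
  | tmul a s =>
    have e : a ⊗ₜ[K] s = a • ((1 : PolyRing K E) ⊗ₜ[K] s) := by
      rw [TensorProduct.smul_tmul', smul_eq_mul, mul_one]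
    rw [e, termRep_smul, map_smul, map_smul, termRep_smul, termRep_eq, termRep_eq,
      TensorProduct.map_tmul, AlgHom.toLinearMap_apply, map_one, LinearMap.map_smul_of_tower]
    congr 2
    exact h g s
  | add x y hx hy => simp only [map_add, hx, hy]

end Restriction

/-! ### Existence of the differentials, and the complex property. -/

section Existence

variable {K : Type*} [Field K] [CharZero K] {E : Type*} [AddCommGroup E] [Module K E] {m : ℕ}
  {d : Fin (m + 1) → ℤ}

lemma exists_isDifferential (b : Module.Basis (Fin m) K E) (hd : StrictMono d) :
    ∃ φ, IsDifferential K E d φ := by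
  let f : ∀ k : Fin m, Gen K E d k.succ →ₗ[K] Term K E d k.castSucc := fun k =>
    pieriMap K E (shape_le_succ hd k)
  have hf : ∀ k, genMap ((f k).liftBaseChange (PolyRing K E)) = f k := fun k => by
    ext1 s
    rw [genMap_apply, LinearMap.liftBaseChange_one_tmul]
  refine ⟨fun k => (f k).liftBaseChange (PolyRing K E), fun k h0 => ?_, fun k => ?_,
    fun k n x hx => ?_⟩
  · have h1 := hf k
    rw [h0] at h1
    exact pieriMap_ne_zero b (shape_le_succ hd k) (fun j hj => shape_succ_of_ne k j hj)
      (h1.symm.trans (by ext1 s; rfl))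
  · refine equivariant_of_genMap ?_
    rw [hf]
    exact pieriMap_isEquivariant _
  · obtain ⟨y, rfl⟩ := hx
    induction y using TensorProduct.induction_on with
    | zero => simp
    | tmul c s =>
      rw [TensorProduct.map_tmul, LinearMap.liftBaseChange_tmul]
      have h1 := pieriMap_mem (K := K) (E := E) (shape_le_succ hd k) s
      have h2 : f k s ∈ termDeg K E d k.castSucc (d k.succ) := by
        have h3 : d k.succ - d k.castSucc =
            (Fintype.card (SkewBox (shape d k.castSucc) (shape d k.succ)) : ℤ) := by
          rw [card_skewBox (shape_le_succ hd k) fun j hj => shape_succ_of_ne k j hj]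
          have h4 := shape_succ_self hd k
          have h5 := shape_le_succ hd k k
          have h6 : diffSeq d k = d k.succ - d k.castSucc := rfl
          omega
        rw [termDeg, h3]
        exact h1
      have h3 := smul_mem_termDeg c.2 h2
      rwa [sub_add_cancel] at h3
    | add x y hx hy =>
      rw [map_add, map_add]
      exact Submodule.add_mem _ hx hy

/-- On generators the composite is an equivariant map for a skew shape with two boxes in one column,
so Pieri's rule kills it. -/
lemma IsDifferential.comp_eq_zero (b : Module.Basis (Fin m) K E) (hd : StrictMono d)
    {φ : ∀ k : Fin m, Term K E d k.succ →ₗ[PolyRing K E] Term K E d k.castSucc}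
    (hφ : IsDifferential K E d φ) (k : ℕ) (h : k + 1 < m)
    (x : Term K E d (Fin.succ ⟨k + 1, h⟩)) : φ ⟨k, by omega⟩ (φ ⟨k + 1, h⟩ x) = 0 := by
  let ψ : Term K E d (Fin.succ ⟨k + 1, h⟩) →ₗ[PolyRing K E] Term K E d (Fin.castSucc ⟨k, by omega⟩) :=
    φ ⟨k, by omega⟩ ∘ₗ φ ⟨k + 1, h⟩
  have hψ : ∀ g x, ψ (termRep K E d _ g x) = termRep K E d _ g (ψ x) := fun g x => by
    have h1 := hφ.equivariant ⟨k + 1, h⟩ g x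
    have h2 := hφ.equivariant ⟨k, by omega⟩ g (φ ⟨k + 1, h⟩ x)
    simp only [ψ, LinearMap.comp_apply]
    rw [h1]
    exact h2
  have h0 : genMap ψ = 0 := by
    have hk : (⟨k, by omega⟩ : Fin m) < ⟨k + 1, h⟩ := Nat.lt_succ_self k
    refine (genMap_isEquivariant hψ).eq_zero_of_column b (shape_antitone hd _) (shape_antitone hd _)
      hk (fun j hj hj' => ?_) ?_ (shape_overlap hd k h)
    · exact (shape_succ_of_ne _ j hj').trans (shape_succ_of_ne ⟨k, by omega⟩ j hj)
    · exact (shape_le_succ hd ⟨k, by omega⟩ _).trans (shape_le_succ hd ⟨k + 1, h⟩ _)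
  have h1 : ψ = 0 := genMap_injective (h0.trans (by ext1 s; rfl))
  exact LinearMap.congr_fun h1 x

end Existence

/-! ### Self-duality of the complex. -/

section Duality

variable {K : Type*} [Field K] {E : Type*} [AddCommGroup E] [Module K E] {m : ℕ}
  (b : Module.Basis (Fin m) K E) {d : Fin (m + 1) → ℤ} (hd : StrictMono d)
  (hsymm : ∀ j : Fin m, diffSeq d j = diffSeq d j.rev)

/-- The pairing of `S_{α(d, i)} E` and `S_{α(d, j)} E` for `i + j = m`. -/
noncomputable def genPairing (i j : Fin (m + 1)) (h : (i : ℕ) + j = m) :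
    Gen K E d i →ₗ[K] Gen K E d j →ₗ[K] K :=
  schurPairing b (shape_add_shape hd hsymm i j h)

lemma genPairing_nondegenerate [CharZero K] (i j : Fin (m + 1)) (h : (i : ℕ) + j = m) :
    (genPairing (K := K) (E := E) b hd hsymm i j h).Nondegenerate :=
  schurPairing_nondegenerate b _ (shape_antitone hd i) (shape_antitone hd j)

lemma genPairing_equivariant (i j : Fin (m + 1)) (h : (i : ℕ) + j = m) (g : GLin K E)
    (s : Gen K E d i) (t : Gen K E d j) :
    genPairing b hd hsymm i j h (genRep K E d i g s) (genRep K E d j g t) =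
      detPow K E (dualWeight d) g * genPairing b hd hsymm i j h s t := by
  change genPairing b hd hsymm i j h (detPow K E (d 0) g • schurRep K E (shape d i) g s)
    (detPow K E (d 0) g • schurRep K E (shape d j) g t) = _
  rw [map_smul, map_smul, LinearMap.smul_apply, genPairing, schurPairing_schurRep, smul_eq_mul,
    smul_eq_mul, ← mul_assoc, ← mul_assoc]
  congr 1
  have hg : LinearMap.det (g : E →ₗ[K] E) ≠ 0 := by
    have := detPow_ne_zero 1 g
    simpa [detPow] using this
  change LinearMap.det (g : E →ₗ[K] E) ^ d 0 * LinearMap.det (g : E →ₗ[K] E) ^ d 0 * _ =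
    LinearMap.det (g : E →ₗ[K] E) ^ dualWeight d
  -- The two twists give `2 d_0` and the rectangle `c - 2 d_0`, together `c`.
  rw [← zpow_natCast, ← zpow_add₀ hg, ← zpow_add₀ hg,
    Int.toNat_of_nonneg (by have := le_dualWeight hd; omega)]
  congr 1
  ring

lemma dualMap_termRep (i j : Fin (m + 1)) (h : (i : ℕ) + j = m) (g : GLin K E)
    (x : Term K E d i) (y : Term K E d j) :
    dualMap (PolyRing K E) (genPairing b hd hsymm i j h) (termRep K E d i g x)
      (termRep K E d j g y) = detPow K E (dualWeight d) g • symMap K E g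
        (dualMap (PolyRing K E) (genPairing b hd hsymm i j h) x y) := by
  induction x using TensorProduct.induction_on with
  | zero => simp
  | tmul a s =>
    induction y using TensorProduct.induction_on with
    | zero => simp
    | tmul a' t =>
      have e1 : termRep K E d i g (a ⊗ₜ s) = symMap K E g a ⊗ₜ genRep K E d i g s := rfl
      have e2 : termRep K E d j g (a' ⊗ₜ t) = symMap K E g a' ⊗ₜ genRep K E d j g t := rfl
      rw [e1, e2, dualMap_tmul, dualMap_tmul, genPairing_equivariant, map_mul, map_mul, map_mul,
        AlgHom.commutes, Algebra.smul_def]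
      ring
    | add y y' hy hy' => simp only [map_add, hy, hy', smul_add]
  | add x x' hx hx' => simp only [map_add, LinearMap.add_apply, hx, hx', smul_add]

variable {φ : ∀ k : Fin m, Term K E d k.succ →ₗ[PolyRing K E] Term K E d k.castSucc}

lemma dualAct_comp (hφ : IsDifferential K E d φ) (l : Fin m) (g : GLin K E)
    (f : DualTerm K E d l.castSucc) :
    dualAct K E d l.castSucc g f ∘ₗ φ l = dualAct K E d l.succ g (f ∘ₗ φ l) := by
  refine LinearMap.ext fun y => ?_
  change symMap K E g (f (termRep K E d _ g⁻¹ (φ l y))) =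
    symMap K E g (f (φ l (termRep K E d _ g⁻¹ y)))
  rw [hφ.equivariant]

instance finiteDimensional_schurModule [FiniteDimensional K E] (ν : Fin m → ℕ) :
    FiniteDimensional K (SchurModule K E ν) :=
  have : FiniteDimensional K (BoxTensor K E ν) := Module.Finite.of_basis
    (Basis.piTensorProduct fun _ => Module.finBasis K E)
  inferInstance

variable [CharZero K] [FiniteDimensional K E]

/-- The isomorphism `F(d)_j^* ≅ F(d)_i` for `i + j = m`. -/
noncomputable def dualIso (i j : Fin (m + 1)) (h : (i : ℕ) + j = m) :
    DualTerm K E d j ≃ₗ[PolyRing K E] Term K E d i :=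
  (dualEquiv (PolyRing K E) (genPairing_nondegenerate (K := K) (E := E) b hd hsymm i j h)).symm

lemma dualIso_symm_apply (i j : Fin (m + 1)) (h : (i : ℕ) + j = m) (x : Term K E d i) :
    (dualIso b hd hsymm i j h).symm x =
      dualMap (PolyRing K E) (genPairing b hd hsymm i j h) x := rfl

lemma dualIso_equivariant (i j : Fin (m + 1)) (h : (i : ℕ) + j = m) (g : GLin K E)
    (f : DualTerm K E d j) :
    detPow K E (dualWeight d) g • dualIso b hd hsymm i j h (dualAct K E d j g f) =
      termRep K E d i g (dualIso b hd hsymm i j h f) := by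
  obtain ⟨x, rfl⟩ := (dualIso b hd hsymm i j h).symm.surjective f
  rw [LinearEquiv.apply_symm_apply]
  refine (dualIso b hd hsymm i j h).symm.injective (LinearMap.ext fun y => ?_)
  have e : y = termRep K E d j g (termRep K E d j g⁻¹ y) :=
    (Representation.self_inv_apply _ _ _).symm
  conv_rhs => rw [e, dualIso_symm_apply, dualMap_termRep]
  rw [linearEquiv_map_smul_of_tower, LinearEquiv.symm_apply_apply]
  rfl

lemma dualIso_degree (i j : Fin (m + 1)) (h : (i : ℕ) + j = m) (n : ℤ) (f : DualTerm K E d j) :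
    IsDualHomogeneous K E d j n f ↔
      dualIso b hd hsymm i j h f ∈ termDeg K E d i (n + (d 0 + d (Fin.last m))) := by
  obtain ⟨x, rfl⟩ := (dualIso b hd hsymm i j h).symm.surjective f
  rw [LinearEquiv.apply_symm_apply, isDualHomogeneous_iff, termDeg,
    mem_range_map_iff (genPairing_nondegenerate (K := K) (E := E) b hd hsymm i j h)]
  -- The shift is uniform in `i` because `d_i + d_j = d_0 + d_m` for `i + j = m`.
  have e : n + (d 0 + d (Fin.last m)) - d i = d j + n := by
    have := degree_add_degree hsymm i j h
    linarith
  rw [e]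
  rfl

/-- The transpose of `φ_l`, regarded as a map `F(d)_{k + 1} → F(d)_k`, is proportional to `φ_k`. -/
lemma exists_smul_dualIso (hφ : IsDifferential K E d φ) (k l : Fin m) (h : (k : ℕ) + l + 1 = m) :
    ∃ s : Kˣ, ∀ f : DualTerm K E d l.castSucc,
      φ k (dualIso b hd hsymm k.succ l.castSucc (by simp; omega) f) =
        (s : K) • dualIso b hd hsymm k.castSucc l.succ (by simp; omega) (f ∘ₗ φ l) := by
  have h1 : (k.succ : ℕ) + l.castSucc = m := by simp; omega
  have h2 : (k.castSucc : ℕ) + l.succ = m := by simp; omega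
  let ψ : Term K E d k.succ →ₗ[PolyRing K E] Term K E d k.castSucc :=
    (dualIso b hd hsymm k.castSucc l.succ h2).toLinearMap ∘ₗ (φ l).dualMap ∘ₗ
      (dualIso b hd hsymm k.succ l.castSucc h1).symm.toLinearMap
  have hψf : ∀ f, ψ (dualIso b hd hsymm k.succ l.castSucc h1 f) =
      dualIso b hd hsymm k.castSucc l.succ h2 (f ∘ₗ φ l) := fun f => by
    simp only [ψ, LinearMap.comp_apply, LinearEquiv.coe_coe, LinearEquiv.symm_apply_apply]
    rfl
  have hψ : ∀ g x, ψ (termRep K E d k.succ g x) = termRep K E d k.castSucc g (ψ x) := by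
    intro g x
    obtain ⟨f, rfl⟩ := (dualIso b hd hsymm k.succ l.castSucc h1).surjective x
    rw [← dualIso_equivariant, LinearMap.map_smul_of_tower, hψf, hψf, dualAct_comp hφ,
      dualIso_equivariant]
  -- If the transpose of `φ l` were zero, every functional would vanish on the image of `φ l`;
  -- functionals separate points of a free module.
  have hne : genMap ψ ≠ 0 := by
    intro h0
    have hψ0 : ψ = 0 := genMap_injective (h0.trans (by ext1 s; rfl))
    refine hφ.ne_zero l (LinearMap.ext fun y => ?_)
    refine (Module.forall_dual_apply_eq_zero_iff (PolyRing K E) _).1 fun f => ?_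
    have h3 := hψf f
    rw [hψ0, LinearMap.zero_apply] at h3
    have h4 := (LinearEquiv.map_eq_zero_iff _).1 h3.symm
    exact LinearMap.congr_fun h4 y
  obtain ⟨s, hs⟩ := (genMap_isEquivariant (hφ.equivariant k)).exists_smul b
    (genMap_isEquivariant hψ) (shape_antitone hd _) (shape_antitone hd _)
    (shape_le_succ hd k) hne
  have hφψ : φ k = s • ψ := genMap_injective hs
  have hs0 : s ≠ 0 := by
    rintro rfl
    exact hφ.ne_zero k (by rw [hφψ, zero_smul])
  refine ⟨Units.mk0 s hs0, fun f => ?_⟩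
  rw [hφψ, LinearMap.smul_apply, hψf]
  rfl

/-- Each square commutes up to a unit `s k`; multiplying the isomorphism in degree `i` by a suitable
`t i` corrects all squares at once. -/
lemma nonempty_selfDuality (b : Module.Basis (Fin m) K E) (hd : StrictMono d)
    (hsymm : ∀ j : Fin m, diffSeq d j = diffSeq d j.rev) (hφ : IsDifferential K E d φ) : Nonempty (SelfDuality K E d φ) := by
  have hs : ∀ k : Fin m, ∃ s : Kˣ, ∀ (l : Fin m) (h : (k : ℕ) + l + 1 = m)
      (f : DualTerm K E d l.castSucc),
      φ k (dualIso b hd hsymm k.succ l.castSucc (by simp; omega) f) =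
        (s : K) • dualIso b hd hsymm k.castSucc l.succ (by simp; omega) (f ∘ₗ φ l) := by
    intro k
    obtain ⟨s, hs⟩ := exists_smul_dualIso b hd hsymm hφ k k.rev (by rw [Fin.val_rev]; omega)
    refine ⟨s, fun l h f => ?_⟩
    obtain rfl : l = k.rev := Fin.ext (by rw [Fin.val_rev]; omega)
    exact hs f
  choose s hs using hs
  -- Solves `t (k + 1) * s k = t k` with `t 0 = 1`, which is the condition for the rescaled squares
  -- to commute.
  let t : ℕ → Kˣ := fun n => ∏ k ∈ Finset.univ.filter (fun k : Fin m => (k : ℕ) < n), (s k)⁻¹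
  have ht : ∀ k : Fin m, t (k + 1) * s k = t k := by
    intro k
    have : Finset.univ.filter (fun k' : Fin m => (k' : ℕ) < k + 1) =
        insert k (Finset.univ.filter fun k' : Fin m => (k' : ℕ) < k) := by
      ext k'
      simp only [Finset.mem_filter, Finset.mem_univ, true_and, Finset.mem_insert, Fin.ext_iff]
      omega
    simp only [t]
    rw [this, Finset.prod_insert (by simp), mul_right_comm, inv_mul_cancel, one_mul]
  let iso : ∀ i j : Fin (m + 1), (i : ℕ) + j = m →
      (DualTerm K E d j ≃ₗ[PolyRing K E] Term K E d i) := fun i j h =>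
    (dualIso b hd hsymm i j h).trans (DistribMulAction.toLinearEquiv (PolyRing K E) _ (t i))
  have iso_apply : ∀ i j h f, iso i j h f = (t i : K) • dualIso b hd hsymm i j h f :=
    fun i j h f => rfl
  refine ⟨{
    -- The pairing describes the inverse of `iso`, hence the inverse scalar.
    pairing := fun i j h => ((t i)⁻¹ : Kˣ) • genPairing b hd hsymm i j h
    pairing_nondegenerate := fun i j h => ?_
    pairing_equivariant := fun i j h g x y => ?_
    iso := iso
    iso_comm := fun k l h f => ?_
    iso_equivariant := fun i j h g f => ?_
    iso_degree := fun i j h n f => ?_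
    iso_extends := fun i j h x y => ?_ }⟩
  · have hn := genPairing_nondegenerate (K := K) (E := E) b hd hsymm i j h
    have hu : (((t i)⁻¹ : Kˣ) : K) ≠ 0 := Units.ne_zero _
    refine ⟨fun x hx => hn.1 x fun y => ?_, fun y hy => hn.2 y fun x => ?_⟩
    · exact (mul_eq_zero.1 (hx y)).resolve_left hu
    · exact (mul_eq_zero.1 (hy x)).resolve_left hu
  · change (((t i)⁻¹ : Kˣ) : K) * genPairing b hd hsymm i j h _ _ =
      _ * ((((t i)⁻¹ : Kˣ) : K) * genPairing b hd hsymm i j h x y)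
    rw [genPairing_equivariant]
    ring
  · rw [iso_apply, iso_apply, LinearMap.map_smul_of_tower, hs k l h f, smul_smul]
    congr 1
    have := congrArg Units.val (ht k)
    exact this
  · rw [iso_apply, iso_apply, map_smul, ← dualIso_equivariant, smul_comm]
  · rw [dualIso_degree b hd hsymm i j h n f, iso_apply, Submodule.smul_mem_iff _ (Units.ne_zero _)]
  · have e : (iso i j h).symm (1 ⊗ₜ x) = (((t i)⁻¹ : Kˣ) : K) •
        (dualIso b hd hsymm i j h).symm (1 ⊗ₜ x) := by
      rw [LinearEquiv.symm_apply_eq, iso_apply, linearEquiv_map_smul_of_tower,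
        LinearEquiv.apply_symm_apply, smul_smul, Units.mul_inv, one_smul]
    rw [e, dualIso_symm_apply, LinearMap.smul_apply, dualMap_tmul, mul_one, one_mul,
      Algebra.smul_def, ← map_mul]
    rfl

end Duality

end PureFree

theorem proposition3p5 (K : Type*) [Field K] [CharZero K]
    (E : Type*) [AddCommGroup E] [Module K E] [FiniteDimensional K E]
    (m : ℕ) (hm : Module.finrank K E = m)
    (d : Fin (m + 1) → ℤ) (hd : StrictMono d)
    (hsymm : ∀ j : Fin m, PureFree.diffSeq d j = PureFree.diffSeq d j.rev) :
    (∃ φ, PureFree.IsDifferential K E d φ) ∧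
    (∀ (i i' : Fin (m + 1)), (i : ℕ) + i' = m → ∀ j : Fin m,
      PureFree.alpha d i j + PureFree.alpha d i' j.rev = PureFree.dualWeight d) ∧
    ∀ φ, PureFree.IsDifferential K E d φ →
      (∀ (k : ℕ) (h : k + 1 < m) (x : PureFree.Term K E d (Fin.succ ⟨k + 1, h⟩)),
        φ ⟨k, by omega⟩ (φ ⟨k + 1, h⟩ x) = 0) ∧
      Nonempty (PureFree.SelfDuality K E d φ) := by
  let b := Module.finBasisOfFinrankEq K E hm
  exact ⟨PureFree.exists_isDifferential b hd, PureFree.alpha_add_alpha hsymm, fun φ hφ =>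
    ⟨hφ.comp_eq_zero b hd, PureFree.nonempty_selfDuality b hd hsymm hφ⟩⟩
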